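/- Let $k$ be a field of characteristic zero, let $m,d\ge 2$, and let $P(X,S)=S^d+f_{d-1}(X)S^{d-1}+\dots+f_0(X)$ with $f_i\in k[X]$. For $n,e\ge 0$ put $$B_{n,P}=k[X,S,Y]/\langle X^nY-P(X,S)\rangle,\qquad R_{n,e,P}=k[X,Y,Z]/\langle X^nY-P(X,\,Y^m-X^eZ)\rangle .$$ Let $x,y,z$ be the classes of $X,Y,Z$ in $R_{n,e,P}$ and $s=y^m-x^ez$. Let $\mathrm{LND}(A)$ be the set of locally nilpotent $k$-derivations of a $k$-algebra $A$. Define $\mathrm{ML}(A)=\bigcap_{D\in\mathrm{LND}(A)}\ker D$. Let $\mathcal D(A)$ and, for $i\ge0$, $\mathrm{AL}_i(A)$ be the subalgebras generated by $\ker D$, respectively $\ker D^{i+1}$, for all nonzero $D\in\mathrm{LND}(A)$. Let $\mathrm{AL}(A)$ be the subalgebra generated by the rings of local slices $L_D=k[\ker D^2]$ for all nonzero $D\in\mathrm{LND}(A)$. Fix $n\ge1$, $e\ge0$ with $(n,e)\ne(1,0)$. The maps $B_{n_0,P}\to B_{n_0+1,P}$ ($Y\mapsto XY$), $B_{n,P}\to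 R_{n,1,P}$ ($S\mapsto Y^m-XZ$) and $R_{n,e_0,P}\to R_{n,e_0+1,P}$ ($Z\mapsto XZ$), the other variables being fixed, are injective and give a chain of subalgebras $$B_{1,P}\subset\dots\subset B_{n,P}\subset R_{n,1,P}\subset\dots\subset R_{n,e,P}$$ (also $B_{0,P}=k[X,S]\subset B_{1,P}$). When $e=0$ the chain consists of the $B_{n_0,P}$ only, and $B_{n,P}\cong R_{n,0,P}$ via $S\mapsto Y^m-Z$. The following hold. (a) Every nonzero $D\in\mathrm{LND}(R_{n,e,P})$ restricts to a nonzero locally nilpotent derivation of $R_{n,e_0,P}$ for every $e_0\in\{1,\dots,e\}$, and of $B_{n_0,P}$ for every $n_0\in\{0,\dots,n\}$. (b) Every $k$-automorphism of $R_{n,e,P}$ restricts to a $k$-automorphism of $R_{n,e_0,P}$ for every $e_0\in\{1,\dots,e\}$, and of $B_{n_0,P}$ for every $n_0\in\{1,\dots,n\}$. (c) For all $n_1,n_2\ge1$ and $e_1,e_2\ge0$, the $k$-algebras $R_{n_1,e_1,P}$ and $R_{n_2,e_2,P}$ (same $P$ and $m$) are isomorphic if and only if $n_1=n_2$ and $e_1=e_2$.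 (d) $\mathrm{ML}(R_{n,e,P})=k[x]$ and $\mathrm{AL}(R_{n,e,P})=k[x,s]$, with $x,s$ algebraically independent over $k$. Each of the subalgebras $\mathrm{ML}(R_{n,e,P})$, $\mathrm{AL}(R_{n,e,P})$, $B_{n_0,P}$ ($1\le n_0\le n$) and $R_{n,e_0,P}$ ($1\le e_0\le e$) of $R_{n,e,P}$ is mapped onto itself by every $k$-automorphism of $R_{n,e,P}$. (e) Writing $R=R_{n,e,P}$, $$\mathrm{AL}_0(R)=\mathcal D(R)=\mathrm{ML}(R)\subsetneq \mathrm{AL}(R)=\mathrm{AL}_1(R)=\dots=\mathrm{AL}_{d-1}(R)\subsetneq B_{n,P}=\mathrm{AL}_d(R)=\dots=\mathrm{AL}_{md-1}(R)\subseteq\mathrm{AL}_{md}(R)=R,$$ and the last inclusion is strict when $e\ge1$. -/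

import Mathlib

noncomputable section

/-! ### Locally nilpotent derivations and the invariants they define -/

section Invariants

variable {k A : Type*} [Field k] [CommRing A] [Algebra k A]

/-- A `k`-derivation `D` of `A` is locally nilpotent if every element is killed by a power of `D`. -/
def IsLND (D : Derivation k A A) : Prop :=
  ∀ a : A, ∃ N : ℕ, (⇑D)^[N] a = 0

variable (k A)

/-- The Makar-Limanov invariant: the intersection of the kernels of all locally nilpotent
derivations of `A`. -/
def ML : Subalgebra k A where
  carrier := {a | ∀ D : Derivation k A A, IsLND D → D a = 0}
  mul_mem' := fun {a b} ha hb D hD => by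
    rw [D.leibniz, ha D hD, hb D hD, smul_zero, smul_zero, add_zero]
  add_mem' := fun {a b} ha hb D hD => by
    rw [map_add, ha D hD, hb D hD, add_zero]
  algebraMap_mem' := fun r D _ => D.map_algebraMap r

/-- The Derksen invariant: the subalgebra generated by the kernels of all nonzero locally
nilpotent derivations of `A`. -/
def Derksen : Subalgebra k A :=
  Algebra.adjoin k {a | ∃ D : Derivation k A A, IsLND D ∧ D ≠ 0 ∧ D a = 0}

/-- `AL_i(A)`: the subalgebra generated by `ker D ^ (i + 1)` for all nonzero locally nilpotent
derivations `D` of `A`. -/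
def ALi (i : ℕ) : Subalgebra k A :=
  Algebra.adjoin k {a | ∃ D : Derivation k A A, IsLND D ∧ D ≠ 0 ∧ (⇑D)^[i + 1] a = 0}

variable {k A}

/-- The ring of local slices of `D`: the subalgebra generated by `ker D ^ 2`. -/
def localSlices (D : Derivation k A A) : Subalgebra k A :=
  Algebra.adjoin k {a | (⇑D)^[2] a = 0}

variable (k A)

/-- The ring of all local slices `AL(A)`: the subalgebra generated by the rings of local slices
of all nonzero locally nilpotent derivations of `A`. -/
def AL : Subalgebra k A :=
  Algebra.adjoin k {a | ∃ D : Derivation k A A, IsLND D ∧ D ≠ 0 ∧ a ∈ localSlices D}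

variable {k A}

/-- A subalgebra which every `k`-algebra automorphism of `A` maps onto itself. -/
def IsInvariantSubalgebra (S : Subalgebra k A) : Prop :=
  ∀ α : A ≃ₐ[k] A, S.map (α : A →ₐ[k] A) = S

variable {C : Type*} [CommRing C] [Algebra k C]

/-- The derivation `D` of `A` restricts, along the embedding `ι` of `C` into `A`, to a nonzero
locally nilpotent derivation of `C`. -/
def RestrictsToNonzeroLND (ι : C →ₐ[k] A) (D : Derivation k A A) : Prop :=
  ∃ D₀ : Derivation k C C, IsLND D₀ ∧ D₀ ≠ 0 ∧ ∀ c : C, D (ι c) = ι (D₀ c)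

/-- The automorphism `α` of `A` restricts, along the embedding `ι` of `C` into `A`, to a
`k`-algebra automorphism of `C`. -/
def RestrictsToAut (ι : C →ₐ[k] A) (α : A ≃ₐ[k] A) : Prop :=
  ∃ α₀ : C ≃ₐ[k] C, ∀ c : C, α (ι c) = ι (α₀ c)

end Invariants

/-! ### The rings and the chain of embeddings -/

section Rings

variable {k : Type*} [Field k]

/-- The value `P(x, s)` of a polynomial `P` in `k[X][S]`. -/
def evalXS {A : Type*} [CommRing A] [Algebra k A] (P : Polynomial (Polynomial k)) (x s : A) : A :=
  P.eval₂ (Polynomial.aeval x : Polynomial k →ₐ[k] A).toRingHom s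

theorem map_evalXS {A C : Type*} [CommRing A] [Algebra k A] [CommRing C] [Algebra k C]
    (f : A →ₐ[k] C) (P : Polynomial (Polynomial k)) (x s : A) :
    f (evalXS P x s) = evalXS P (f x) (f s) := by
  have h : (f : A →+* C).comp (Polynomial.aeval x : Polynomial k →ₐ[k] A).toRingHom =
      (Polynomial.aeval (f x) : Polynomial k →ₐ[k] C).toRingHom := by
    ext <;> simp
  unfold evalXS
  rw [← h]
  exact Polynomial.hom_eval₂ P _ (f : A →+* C) s

/-- The polynomial `X ^ n * Y - P(X, S)`, the variables `X, S, Y` being numbered `0, 1, 2`. -/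
def danielewskiPoly (n : ℕ) (P : Polynomial (Polynomial k)) : MvPolynomial (Fin 3) k :=
  MvPolynomial.X 0 ^ n * MvPolynomial.X 2 - evalXS P (MvPolynomial.X 0) (MvPolynomial.X 1)

/-- The ring `B_{n,P} = k[X, S, Y] / (X ^ n * Y - P(X, S))`. -/
abbrev BRing (n : ℕ) (P : Polynomial (Polynomial k)) : Type _ :=
  MvPolynomial (Fin 3) k ⧸ Ideal.span {danielewskiPoly n P}

/-- The polynomial `X ^ n * Y - P(X, Y ^ m - X ^ e * Z)`, the variables `X, Y, Z` being numbered
`0, 1, 2`. -/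
def rPoly (n e m : ℕ) (P : Polynomial (Polynomial k)) : MvPolynomial (Fin 3) k :=
  MvPolynomial.X 0 ^ n * MvPolynomial.X 1 -
    evalXS P (MvPolynomial.X 0)
      (MvPolynomial.X 1 ^ m - MvPolynomial.X 0 ^ e * MvPolynomial.X 2)

/-- The ring `R_{n,e,P} = k[X, Y, Z] / (X ^ n * Y - P(X, Y ^ m - X ^ e * Z))`. -/
abbrev RRing (n e m : ℕ) (P : Polynomial (Polynomial k)) : Type _ :=
  MvPolynomial (Fin 3) k ⧸ Ideal.span {rPoly n e m P}

namespace BRing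

variable (n : ℕ) (P : Polynomial (Polynomial k))

/-- The class of `X`. -/
def x : BRing n P := Ideal.Quotient.mkₐ k _ (MvPolynomial.X 0)

/-- The class of `S`. -/
def s : BRing n P := Ideal.Quotient.mkₐ k _ (MvPolynomial.X 1)

/-- The class of `Y`. -/
def y : BRing n P := Ideal.Quotient.mkₐ k _ (MvPolynomial.X 2)

theorem relation : x n P ^ n * y n P = evalXS P (x n P) (s n P) := by
  have h : Ideal.Quotient.mkₐ k (Ideal.span {danielewskiPoly n P}) (danielewskiPoly n P) = 0 :=
    Ideal.Quotient.eq_zero_iff_mem.2 (Ideal.subset_span rfl)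
  have h' := sub_eq_zero.1 (((map_sub _ _ _).symm.trans h))
  rw [map_mul, map_pow, map_evalXS] at h'
  exact h'

variable {n P}

/-- The homomorphism out of `B_{n,P}` given by a solution `(a, b, c)` of
`a ^ n * c = P(a, b)`. -/
def lift {A : Type*} [CommRing A] [Algebra k A] (a b c : A) (h : a ^ n * c = evalXS P a b) :
    BRing n P →ₐ[k] A :=
  Ideal.Quotient.liftₐ (Ideal.span {danielewskiPoly n P}) (MvPolynomial.aeval ![a, b, c])
    (by
      have h0 : MvPolynomial.aeval ![a, b, c] (danielewskiPoly n P) = 0 := by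
        simp [danielewskiPoly, map_evalXS, h]
      intro q hq
      obtain ⟨r, rfl⟩ := Ideal.mem_span_singleton'.1 hq
      rw [map_mul, h0, mul_zero])

end BRing

namespace RRing

variable (n e m : ℕ) (P : Polynomial (Polynomial k))

/-- The class of `X`. -/
def x : RRing n e m P := Ideal.Quotient.mkₐ k _ (MvPolynomial.X 0)

/-- The class of `Y`. -/
def y : RRing n e m P := Ideal.Quotient.mkₐ k _ (MvPolynomial.X 1)

/-- The class of `Z`. -/
def z : RRing n e m P := Ideal.Quotient.mkₐ k _ (MvPolynomial.X 2)

/-- The class of `S = Y ^ m - X ^ e * Z`. -/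
def s : RRing n e m P := y n e m P ^ m - x n e m P ^ e * z n e m P

theorem relation :
    x n e m P ^ n * y n e m P = evalXS P (x n e m P) (s n e m P) := by
  have h : Ideal.Quotient.mkₐ k (Ideal.span {rPoly n e m P}) (rPoly n e m P) = 0 :=
    Ideal.Quotient.eq_zero_iff_mem.2 (Ideal.subset_span rfl)
  have h' := sub_eq_zero.1 (((map_sub _ _ _).symm.trans h))
  rw [map_mul, map_pow, map_evalXS, map_sub, map_pow, map_mul, map_pow] at h'
  exact h'

variable {n e m P}

/-- The homomorphism out of `R_{n,e,P}` given by a solution `(a, b, c)` of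
`a ^ n * b = P(a, b ^ m - a ^ e * c)`. -/
def lift {A : Type*} [CommRing A] [Algebra k A] (a b c : A)
    (h : a ^ n * b = evalXS P a (b ^ m - a ^ e * c)) : RRing n e m P →ₐ[k] A :=
  Ideal.Quotient.liftₐ (Ideal.span {rPoly n e m P}) (MvPolynomial.aeval ![a, b, c])
    (by
      have h0 : MvPolynomial.aeval ![a, b, c] (rPoly n e m P) = 0 := by
        simp [rPoly, map_evalXS, h]
      intro q hq
      obtain ⟨r, rfl⟩ := Ideal.mem_span_singleton'.1 hq
      rw [map_mul, h0, mul_zero])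

end RRing

/-- The map `B_{n₀,P} → B_{n,P}`, `X ↦ X`, `S ↦ S`, `Y ↦ X ^ (n - n₀) * Y`: the composite of the
`n - n₀` steps `Y ↦ X * Y`. -/
def bToB {n₀ n : ℕ} (h : n₀ ≤ n) (P : Polynomial (Polynomial k)) : BRing n₀ P →ₐ[k] BRing n P :=
  BRing.lift (BRing.x n P) (BRing.s n P) (BRing.x n P ^ (n - n₀) * BRing.y n P)
    (by rw [← mul_assoc, ← pow_add, Nat.add_sub_cancel' h, BRing.relation])

/-- The map `B_{n,P} → R_{n,e,P}`, `X ↦ X`, `S ↦ Y ^ m - X ^ e * Z`, `Y ↦ Y`: the composite of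
the step `S ↦ Y ^ m - X * Z` into `R_{n,1,P}` with the steps `Z ↦ X * Z` when `1 ≤ e`, and the
standard identification of `B_{n,P}` with `R_{n,0,P}` when `e = 0`. -/
def bToR (n e m : ℕ) (P : Polynomial (Polynomial k)) : BRing n P →ₐ[k] RRing n e m P :=
  BRing.lift (RRing.x n e m P) (RRing.s n e m P) (RRing.y n e m P) (RRing.relation n e m P)

/-- The map `R_{n,e₀,P} → R_{n,e,P}`, `X ↦ X`, `Y ↦ Y`, `Z ↦ X ^ (e - e₀) * Z`: the composite of
the `e - e₀` steps `Z ↦ X * Z`. -/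
def rEmb (n : ℕ) {e₀ e : ℕ} (h : e₀ ≤ e) (m : ℕ) (P : Polynomial (Polynomial k)) :
    RRing n e₀ m P →ₐ[k] RRing n e m P :=
  RRing.lift (RRing.x n e m P) (RRing.y n e m P) (RRing.x n e m P ^ (e - e₀) * RRing.z n e m P)
    (by
      rw [← mul_assoc, ← pow_add, Nat.add_sub_cancel' h, RRing.relation]
      rfl)

/-- The map `B_{n₀,P} → R_{n,e,P}` of the chain: `B_{n₀,P} → B_{n,P} → R_{n,e,P}`. -/
def bEmb {n₀ n : ℕ} (h : n₀ ≤ n) (e m : ℕ) (P : Polynomial (Polynomial k)) :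
    BRing n₀ P →ₐ[k] RRing n e m P :=
  (bToR n e m P).comp (bToB h P)

end Rings

end

/-! Since `y = x ^ (-n) * P(x, s)` and `z = x ^ (-e) * (y ^ m - s)`, the ring `R = R_{n,e,P}` maps
to the Laurent polynomials in `s` and `x`, and everything is measured by the degree in `s`. The
products `s ^ i * y ^ j * z ^ l` with `i < d` and `j < m` have degree `i + d * j + m * d * l`, so
each `N` is the degree of exactly one of them, and its leading coefficient is `x ^ (-pole N)`. The
relations reduce every element of `R` to a `k[x]`-combination of these products (`span_monomial`).
As their degrees differ, leading terms cannot cancel: the map to Laurent polynomials is injective,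
the elements of degree at most `N` are spanned by the products of degree at most `N`
(`degFil_eq_span`), and a leading coefficient in degree `N` has a pole of order at most `pole N`
along `x = 0` (`coeff_toLaurent_eq_zero`).

The derivation `E = x ^ (n + e) * d/ds` preserves `R` and is locally nilpotent. The core of the
proof is that every locally nilpotent `D` equals `h(x) * E` (`lnd_eq_smul`). By the chain rule `D`
is `p * X d/dX + q * S d/dS` with Laurent polynomials `p`, `q`. If `Δ` is the lexicographically
largest exponent occurring in `p` or `q`, then on leading terms `D` shifts the exponent `w` by `Δ`
and multiplies by a linear form `l w`. Nilpotency makes `l` take values in `-ℕ * l Δ` at leading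
exponents of `R`; with the bound on poles, an elementary inequality argument excludes `0 ≤ Δ.1` as
soon as `(n, e) ≠ (1, 0)` (`shift_fst_neg`). So `D x = 0` and `D s = f(x)`, and the pole of the
leading coefficient of `D z` forces `x ^ (n + e)` to divide `f` (`lnd_map_s_dvd`).

Consequently `ker D ^ (i + 1)` is the space of elements of degree at most `i` for every nonzero `D`
(`iterate_lnd_eq_zero_iff`). All the invariants are then read off from the degrees `0, 1, d, m * d`
of `x, s, y, z`. Isomorphisms preserve the degree filtration, hence send `x` to a multiple of `x`
and `y`, `z` to `q(x) * y + r`, `q(x) * z + r` with `r` of lower degree; this gives invariance of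
the chain. Comparing basic derivations shows that `n + e` is an isomorphism invariant; applied to
the characteristic subring `B_{n,P} ≅ R_{n,0,P}`, the same argument recovers `n`. The excluded ring
`R_{1,0,P}` is set apart by an automorphism that does not preserve `k[x]`. -/

noncomputable section

/-! ### Laurent polynomials in two variables -/

/-- Laurent polynomials over `k` in two variables `S, X`; the monomial `S ^ a * X ^ b` has
exponent `(a, b)`. -/
abbrev Laurent2 (k : Type*) [Field k] : Type _ := AddMonoidAlgebra k (ℤ × ℤ)

namespace Laurent2

variable {k : Type*} [Field k]

/-- The monomial `S ^ a * X ^ b`. -/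
def mono (a b : ℤ) : Laurent2 k := AddMonoidAlgebra.single (a, b) 1

theorem coeff_mono (a b : ℤ) (g : ℤ × ℤ) :
    (mono a b : Laurent2 k).coeff g = if (a, b) = g then 1 else 0 := by
  classical
  simp [mono, Finsupp.single_apply]

theorem mono_mul (a b c d : ℤ) : (mono a b * mono c d : Laurent2 k) = mono (a + c) (b + d) := by
  simp [mono, AddMonoidAlgebra.single_mul_single]

theorem mono_zero : (mono 0 0 : Laurent2 k) = 1 := rfl

theorem mono_pow (a b : ℤ) (n : ℕ) : (mono a b : Laurent2 k) ^ n = mono (n * a) (n * b) := by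
  induction n with
  | zero => simp [mono_zero]
  | succ n ih => rw [pow_succ, ih, mono_mul]; push_cast; ring_nf

theorem mono_ne_zero (a b : ℤ) : (mono a b : Laurent2 k) ≠ 0 := by
  intro h
  have := coeff_mono (k := k) a b (a, b)
  simp [h] at this

theorem coeff_mono_mul (a b : ℤ) (f : Laurent2 k) (g : ℤ × ℤ) :
    (mono a b * f).coeff g = f.coeff (g.1 - a, g.2 - b) := by
  rw [mono, AddMonoidAlgebra.coeff_single_mul_apply, one_mul]
  congr 1
  ext <;> simp <;> ring

theorem exists_coeff_ne_zero_of_mul {f g : Laurent2 k} {w : ℤ × ℤ} (h : (f * g).coeff w ≠ 0) :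
    ∃ u v, u + v = w ∧ f.coeff u ≠ 0 ∧ g.coeff v ≠ 0 := by
  classical
  have := AddMonoidAlgebra.support_coeff_mul_subset f g (Finsupp.mem_support_iff.2 h)
  obtain ⟨u, hu, v, hv, rfl⟩ := Finset.mem_add.1 this
  exact ⟨u, v, rfl, Finsupp.mem_support_iff.1 hu, Finsupp.mem_support_iff.1 hv⟩

/-- The Laurent polynomials of `S`-degree at most `N`. -/
def degLE (k : Type*) [Field k] (N : ℤ) : Submodule k (Laurent2 k) where
  carrier := {f | ∀ g : ℤ × ℤ, N < g.1 → f.coeff g = 0}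
  add_mem' := fun {a b} ha hb g hg => by simp [ha g hg, hb g hg]
  zero_mem' := fun g _ => rfl
  smul_mem' := fun c f hf g hg => by simp [hf g hg]

theorem degLE_mono {M N : ℤ} (h : M ≤ N) : degLE k M ≤ degLE k N :=
  fun _ hf g hg => hf g (h.trans_lt hg)

theorem mul_mem_degLE {M N : ℤ} {f g : Laurent2 k} (hf : f ∈ degLE k M) (hg : g ∈ degLE k N) :
    f * g ∈ degLE k (M + N) := by
  intro w hw
  by_contra h
  obtain ⟨u, v, rfl, hu, hv⟩ := exists_coeff_ne_zero_of_mul h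
  rcases lt_or_ge M u.1 with h1 | h1
  · exact hu (hf u h1)
  · refine hv (hg v ?_)
    rw [Prod.fst_add] at hw
    lia

theorem mono_mem_degLE {a b N : ℤ} (h : a ≤ N) : (mono a b : Laurent2 k) ∈ degLE k N := by
  intro g hg
  rw [coeff_mono, if_neg]
  rintro rfl
  simp at hg
  lia

/-- The Laurent polynomial `f` has leading term `X ^ b` as a polynomial in `S` of degree `a`. -/
def HasLead (f : Laurent2 k) (a b : ℤ) : Prop := f - mono a b ∈ degLE k (a - 1)

theorem hasLead_mono (a b : ℤ) : HasLead (mono a b : Laurent2 k) a b := by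
  simp [HasLead]

theorem HasLead.mem_degLE {f : Laurent2 k} {a b : ℤ} (h : HasLead f a b) : f ∈ degLE k a := by
  have := add_mem (degLE_mono (by lia : a - 1 ≤ a) h) (mono_mem_degLE (k := k) (b := b) le_rfl)
  rwa [sub_add_cancel] at this

theorem HasLead.coeff {f : Laurent2 k} {a b : ℤ} (h : HasLead f a b) (c : ℤ) :
    f.coeff (a, c) = if b = c then 1 else 0 := by
  have := h (a, c) (by simp)
  rw [AddMonoidAlgebra.coeff_sub, Finsupp.sub_apply, coeff_mono, sub_eq_zero] at this
  simpa using this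

theorem HasLead.mul {f g : Laurent2 k} {a b c d : ℤ} (hf : HasLead f a b) (hg : HasLead g c d) :
    HasLead (f * g) (a + c) (b + d) := by
  have h1 := mul_mem_degLE hf hg.mem_degLE
  have h2 := mul_mem_degLE (mono_mem_degLE (k := k) (b := b) (le_refl a)) hg
  have := add_mem (degLE_mono (N := a + c - 1) (by lia) h1) (degLE_mono (by lia) h2)
  rw [HasLead, ← mono_mul]
  convert this using 1
  ring

theorem HasLead.pow {f : Laurent2 k} {a b : ℤ} (hf : HasLead f a b) (n : ℕ) :
    HasLead (f ^ n) (n * a) (n * b) := by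
  induction n with
  | zero => simpa [mono_zero] using hasLead_mono (k := k) 0 0
  | succ n ih =>
    rw [pow_succ]
    convert ih.mul hf using 1 <;> push_cast <;> ring

theorem HasLead.sub_of_lt {f g : Laurent2 k} {a b c : ℤ} (hf : HasLead f a b)
    (hg : g ∈ degLE k c) (hc : c < a) : HasLead (f - g) a b := by
  have := sub_mem hf (degLE_mono (by lia : c ≤ a - 1) hg)
  rw [HasLead]
  convert this using 1
  ring

/-- The linear map multiplying the monomial of exponent `g` by `φ g`. -/
def eulerLinear (φ : ℤ × ℤ →+ k) : Laurent2 k →ₗ[k] Laurent2 k :=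
  (AddMonoidAlgebra.coeffLinearEquiv k).symm.toLinearMap ∘ₗ
    Finsupp.lsum k (fun g => φ g • Finsupp.lsingle g) ∘ₗ
    (AddMonoidAlgebra.coeffLinearEquiv k).toLinearMap

theorem eulerLinear_single (φ : ℤ × ℤ →+ k) (g : ℤ × ℤ) (r : k) :
    eulerLinear φ (AddMonoidAlgebra.single g r) = AddMonoidAlgebra.single g (φ g * r) := by
  ext
  simp [eulerLinear]

/-- The derivation multiplying the monomial of exponent `g` by `φ g`. -/
def euler (φ : ℤ × ℤ →+ k) : Derivation k (Laurent2 k) (Laurent2 k) :=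
  Derivation.mk' (eulerLinear φ) (by
    intro a b
    induction a using AddMonoidAlgebra.induction_linear with
    | zero => simp
    | add f g hf hg => rw [add_mul, map_add, hf, hg, map_add]; simp only [smul_eq_mul]; ring
    | single u r =>
      induction b using AddMonoidAlgebra.induction_linear with
      | zero => simp
      | add f g hf hg => rw [mul_add, map_add, hf, hg, map_add]; simp only [smul_eq_mul]; ring
      | single v t =>
        rw [AddMonoidAlgebra.single_mul_single, eulerLinear_single, eulerLinear_single,
          eulerLinear_single, smul_eq_mul, smul_eq_mul, AddMonoidAlgebra.single_mul_single,
          AddMonoidAlgebra.single_mul_single, add_comm v u, ← AddMonoidAlgebra.single_add, map_add]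
        congr 1
        ring)

theorem coeff_euler (φ : ℤ × ℤ →+ k) (f : Laurent2 k) (g : ℤ × ℤ) :
    (euler φ f).coeff g = φ g * f.coeff g := by
  change (eulerLinear φ f).coeff g = _
  induction f using AddMonoidAlgebra.induction_linear with
  | zero => simp
  | add f g hf hg => simp [hf, hg, mul_add]
  | single u r =>
    rw [eulerLinear_single]
    by_cases h : u = g
    · simp [h]
    · simp [h]

theorem euler_mono (φ : ℤ × ℤ →+ k) (a b : ℤ) :
    euler φ (mono a b) = φ (a, b) • mono a b := by
  change eulerLinear φ _ = _
  rw [mono, eulerLinear_single, AddMonoidAlgebra.smul_single, smul_eq_mul]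

/-- The exponents of `f` are at most `w` in the lexicographic order. -/
def LexLE (f : Laurent2 k) (w : ℤ × ℤ) : Prop := ∀ g, f.coeff g ≠ 0 → toLex g ≤ toLex w

theorem HasLead.lexLE {f : Laurent2 k} {a b : ℤ} (h : HasLead f a b) : LexLE f (a, b) := by
  rintro ⟨c, d⟩ hg
  rw [Prod.Lex.toLex_le_toLex]
  by_contra! h1
  rcases h1.1.lt_or_eq with h2 | h2
  · exact hg (h.mem_degLE _ h2)
  · simp only at h2
    subst h2
    rw [h.coeff] at hg
    have := h1.2 rfl
    rw [if_neg (by simp at this; lia)] at hg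
    exact hg rfl

theorem LexLE.mul {f g : Laurent2 k} {u w : ℤ × ℤ} (hf : LexLE f u) (hg : LexLE g w) :
    LexLE (f * g) (u + w) := by
  intro v hv
  obtain ⟨a, b, rfl, ha, hb⟩ := exists_coeff_ne_zero_of_mul hv
  exact add_le_add (hf a ha) (hg b hb)

/-- The lexicographic order is compatible with addition, so `(u, w)` is the only pair of exponents
that can contribute to `u + w`. -/
theorem LexLE.coeff_mul {f g : Laurent2 k} {u w : ℤ × ℤ} (hf : LexLE f u) (hg : LexLE g w) :
    (f * g).coeff (u + w) = f.coeff u * g.coeff w := by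
  refine AddMonoidAlgebra.coeff_mul_add_of_uniqueAdd ?_
  intro a b ha hb hab
  have h1 := hf a (Finsupp.mem_support_iff.1 ha)
  have h2 := hg b (Finsupp.mem_support_iff.1 hb)
  have h3 : toLex a + toLex b = toLex u + toLex w := congrArg toLex hab
  obtain ⟨h4, h5⟩ := (add_eq_add_iff_eq_and_eq h1 h2).1 h3
  exact ⟨toLex.injective h4, toLex.injective h5⟩

theorem LexLE.add {f g : Laurent2 k} {w : ℤ × ℤ} (hf : LexLE f w) (hg : LexLE g w) :
    LexLE (f + g) w := by
  intro v hv
  by_contra h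
  have h1 : f.coeff v = 0 := by_contra fun h1 => h (hf v h1)
  have h2 : g.coeff v = 0 := by_contra fun h1 => h (hg v h1)
  simp [h1, h2] at hv

theorem LexLE.euler {f : Laurent2 k} {w : ℤ × ℤ} (hf : LexLE f w) (φ : ℤ × ℤ →+ k) :
    LexLE (euler φ f) w := by
  intro v hv
  rw [coeff_euler] at hv
  exact hf v (right_ne_zero_of_mul hv)

/-- A common bound for two Laurent polynomials, attained by at least one of them: it serves for the
two coefficients of a derivation, whose symbol is then nonzero. -/
theorem exists_lexLE {p q : Laurent2 k} (h : p ≠ 0 ∨ q ≠ 0) :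
    ∃ w, LexLE p w ∧ LexLE q w ∧ (p.coeff w ≠ 0 ∨ q.coeff w ≠ 0) := by
  classical
  have hne : (p.coeff.support ∪ q.coeff.support).Nonempty := by
    rw [Finset.union_nonempty, Finsupp.support_nonempty_iff, Finsupp.support_nonempty_iff]
    simpa using h
  obtain ⟨w, hw, hmax⟩ := Finset.exists_max_image _ (fun g : ℤ × ℤ => toLex g) hne
  refine ⟨w, fun g hg => hmax g ?_, fun g hg => hmax g ?_, ?_⟩
  · simp [hg]
  · simp [hg]
  · simpa using hw

end Laurent2

open Laurent2

variable {k : Type*} [Field k]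

theorem evalXS_monic {A : Type*} [CommRing A] [Algebra k A] {P : Polynomial (Polynomial k)}
    (hP : P.Monic) (x s : A) :
    evalXS P x s = s ^ P.natDegree +
      ∑ i ∈ Finset.range P.natDegree, Polynomial.aeval x (P.coeff i) * s ^ i := by
  rw [evalXS, Polynomial.eval₂_eq_sum_range, Finset.sum_range_succ, hP.coeff_natDegree, map_one,
    one_mul, add_comm]
  rfl

/-! ### The embedding into Laurent polynomials, the `k[x]`-basis and the degree filtration -/

namespace RRing

variable {n e m : ℕ} {P : Polynomial (Polynomial k)}

theorem adjoin_eq_top :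
    Algebra.adjoin k {x n e m P, y n e m P, z n e m P} = ⊤ := by
  rw [eq_top_iff]
  rintro a -
  obtain ⟨p, rfl⟩ := Ideal.Quotient.mkₐ_surjective k _ a
  induction p using MvPolynomial.induction_on with
  | C r =>
    rw [← MvPolynomial.algebraMap_eq, AlgHom.commutes]
    exact Subalgebra.algebraMap_mem _ r
  | add p q hp hq => rw [map_add]; exact add_mem hp hq
  | mul_X p i hp =>
    rw [map_mul]
    refine mul_mem hp (Algebra.subset_adjoin ?_)
    fin_cases i
    · exact Or.inl rfl
    · exact Or.inr (Or.inl rfl)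
    · exact Or.inr (Or.inr rfl)

theorem algHom_ext' {A : Type*} [CommRing A] [Algebra k A] {f g : RRing n e m P →ₐ[k] A}
    (hx : f (x n e m P) = g (x n e m P)) (hy : f (y n e m P) = g (y n e m P))
    (hz : f (z n e m P) = g (z n e m P)) : f = g := by
  refine AlgHom.ext_of_adjoin_eq_top adjoin_eq_top ?_
  rintro a (rfl | rfl | rfl)
  exacts [hx, hy, hz]

section Lift

variable {A : Type*} [CommRing A] [Algebra k A] (a b c : A)
  (h : a ^ n * b = evalXS P a (b ^ m - a ^ e * c))

theorem lift_x : lift a b c h (x n e m P) = a := by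
  change MvPolynomial.aeval ![a, b, c] (MvPolynomial.X 0) = a
  simp

theorem lift_y : lift a b c h (y n e m P) = b := by
  change MvPolynomial.aeval ![a, b, c] (MvPolynomial.X 1) = b
  simp

theorem lift_z : lift a b c h (z n e m P) = c := by
  change MvPolynomial.aeval ![a, b, c] (MvPolynomial.X 2) = c
  simp

theorem lift_s : lift a b c h (s n e m P) = b ^ m - a ^ e * c := by
  simp [s, lift_x, lift_y, lift_z]

end Lift

/-- The image of `y` in the ring of Laurent polynomials. -/
def yLaurent (n : ℕ) (P : Polynomial (Polynomial k)) : Laurent2 k :=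
  mono 0 (-n) * evalXS P (mono 0 1) (mono 1 0)

/-- The image of `z` in the ring of Laurent polynomials. -/
def zLaurent (n e m : ℕ) (P : Polynomial (Polynomial k)) : Laurent2 k :=
  mono 0 (-e) * (yLaurent n P ^ m - mono 1 0)

theorem mono_mul_yLaurent :
    (mono 0 1 : Laurent2 k) ^ n * yLaurent n P = evalXS P (mono 0 1) (mono 1 0) := by
  rw [yLaurent, ← mul_assoc, mono_pow, mono_mul]
  simp [mono_zero]

theorem mono_mul_zLaurent :
    (mono 0 1 : Laurent2 k) ^ e * zLaurent n e m P = yLaurent n P ^ m - mono 1 0 := by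
  rw [zLaurent, ← mul_assoc, mono_pow, mono_mul]
  simp [mono_zero]

variable (n e m P) in
/-- The embedding of `R_{n,e,P}` into the Laurent polynomials in `s` and `x`. -/
def toLaurent : RRing n e m P →ₐ[k] Laurent2 k :=
  lift (mono 0 1) (yLaurent n P) (zLaurent n e m P)
    (by rw [mono_mul_zLaurent, mono_mul_yLaurent, sub_sub_cancel])

theorem toLaurent_x : toLaurent n e m P (x n e m P) = mono 0 1 := lift_x _ _ _ _

theorem toLaurent_y : toLaurent n e m P (y n e m P) = yLaurent n P := lift_y _ _ _ _

theorem toLaurent_z : toLaurent n e m P (z n e m P) = zLaurent n e m P := lift_z _ _ _ _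

theorem toLaurent_s : toLaurent n e m P (s n e m P) = mono 1 0 := by
  rw [toLaurent, lift_s, mono_mul_zLaurent, sub_sub_cancel]

theorem aeval_mono_mem_degLE (f : Polynomial k) :
    Polynomial.aeval (mono 0 1 : Laurent2 k) f ∈ degLE k 0 := by
  rw [Polynomial.aeval_eq_sum_range]
  refine sum_mem fun i _ => Submodule.smul_mem _ _ ?_
  rw [mono_pow]
  exact mono_mem_degLE (by simp)

theorem hasLead_evalXS (hP : P.Monic) :
    HasLead (evalXS P (mono 0 1) (mono 1 0) : Laurent2 k) P.natDegree 0 := by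
  rw [evalXS_monic hP, HasLead, mono_pow]
  simp only [mul_one, mul_zero, add_sub_cancel_left]
  refine sum_mem fun i hi => ?_
  rw [Finset.mem_range] at hi
  refine degLE_mono ?_ (mul_mem_degLE (aeval_mono_mem_degLE _)
    (mono_pow (k := k) 1 0 i ▸ mono_mem_degLE le_rfl))
  lia

theorem hasLead_yLaurent (n : ℕ) (hP : P.Monic) : HasLead (yLaurent n P) P.natDegree (-n) := by
  simpa [yLaurent] using (hasLead_mono (k := k) 0 (-n)).mul (hasLead_evalXS hP)

theorem hasLead_zLaurent (n e : ℕ) (hP : P.Monic) (hd : 2 ≤ P.natDegree) (hm : 2 ≤ m) :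
    HasLead (zLaurent n e m P) (m * P.natDegree) (-(n * m + e)) := by
  -- Subtracting `s` does not affect the leading term of `y ^ m`, because `1 < m * d`.
  have h1 := ((hasLead_yLaurent n hP).pow m).sub_of_lt (mono_mem_degLE (k := k) (b := 0) (le_refl 1))
    (by norm_cast; nlinarith)
  convert (hasLead_mono (k := k) 0 (-e)).mul h1 using 1
  · rfl
  · ring
  · ring

variable (n e m P) in
/-- The element `s ^ i * y ^ j * z ^ l` with `N = i + d * j + m * d * l`. -/
def monomial (N : ℕ) : RRing n e m P :=
  s n e m P ^ (N % P.natDegree) * y n e m P ^ (N / P.natDegree % m) *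
    z n e m P ^ (N / P.natDegree / m)

/-- The order of the pole along `x = 0` of the leading coefficient in `s` of
`RRing.monomial n e m P N`. -/
def pole (n e m d N : ℕ) : ℕ := n * (N / d % m) + (n * m + e) * (N / d / m)

theorem hasLead_monomial (hP : P.Monic) (hd : 2 ≤ P.natDegree) (hm : 2 ≤ m) (N : ℕ) :
    HasLead (toLaurent n e m P (monomial n e m P N)) N (-pole n e m P.natDegree N) := by
  rw [monomial, map_mul, map_mul, map_pow, map_pow, map_pow, toLaurent_s, toLaurent_y, toLaurent_z]
  have h := (((hasLead_mono (k := k) 1 0).pow (N % P.natDegree)).mul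
    ((hasLead_yLaurent n hP).pow (N / P.natDegree % m))).mul
    ((hasLead_zLaurent n e hP hd hm).pow (N / P.natDegree / m))
  convert h using 1
  · have h1 := Nat.mod_add_div N P.natDegree
    have h2 := Nat.mod_add_div (N / P.natDegree) m
    conv_lhs => rw [← h1, ← h2]
    push_cast
    ring
  · rw [pole]
    push_cast
    ring

theorem hasLead_x_pow_mul_monomial (hP : P.Monic) (hd : 2 ≤ P.natDegree) (hm : 2 ≤ m) (i N : ℕ) :
    HasLead (toLaurent n e m P (x n e m P ^ i * monomial n e m P N)) N
      (i - pole n e m P.natDegree N) := by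
  have h := ((hasLead_mono (k := k) 0 1).pow i).mul (hasLead_monomial (n := n) (e := e) hP hd hm N)
  rw [map_mul, map_pow, toLaurent_x]
  convert h using 1 <;> ring

/-- The exponents are the digits of `N` in the mixed radix with places `1, d, d * m`, so every
admissible triple `(a, b, l)` occurs. -/
theorem exists_monomial_eq (hd : 0 < P.natDegree) (hm : 0 < m) {a b : ℕ} (ha : a < P.natDegree)
    (hb : b < m) (l : ℕ) :
    monomial n e m P (a + P.natDegree * (b + m * l)) =
      s n e m P ^ a * y n e m P ^ b * z n e m P ^ l := by
  have h1 : (a + P.natDegree * (b + m * l)) % P.natDegree = a := by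
    rw [Nat.add_mul_mod_self_left, Nat.mod_eq_of_lt ha]
  have h2 : (a + P.natDegree * (b + m * l)) / P.natDegree = b + m * l := by
    rw [Nat.add_mul_div_left _ _ hd, Nat.div_eq_of_lt ha, zero_add]
  have h3 : (b + m * l) % m = b := by
    rw [Nat.add_mul_mod_self_left, Nat.mod_eq_of_lt hb]
  have h4 : (b + m * l) / m = l := by
    rw [Nat.add_mul_div_left _ _ hm, Nat.div_eq_of_lt hb, zero_add]
  rw [monomial, h1, h2, h3, h4]

theorem aeval_mul_mem {A : Type*} [CommRing A] [Algebra k A] {V : Submodule k A} {x : A}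
    (h : ∀ v ∈ V, x * v ∈ V) (f : Polynomial k) {v : A} (hv : v ∈ V) :
    Polynomial.aeval x f * v ∈ V := by
  induction f using Polynomial.induction_on' with
  | add p q hp hq => rw [map_add, add_mul]; exact add_mem hp hq
  | monomial i r =>
    rw [Polynomial.aeval_monomial, mul_assoc, ← Algebra.smul_def]
    refine Submodule.smul_mem _ _ ?_
    induction i with
    | zero => simpa using hv
    | succ i ih => rw [pow_succ', mul_assoc]; exact h _ ih

/-- The span contains `1` and is stable under multiplication by `x`, `z` and `y`. Only `y` needs
work: `y ^ m` is rewritten as `s + x ^ e * z`, and a resulting `s ^ d` as `x ^ n * y` minus terms of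
lower degree in `s`. -/
theorem span_monomial (hP : P.Monic) (hd : 2 ≤ P.natDegree) (hm : 2 ≤ m) :
    Submodule.span k (Set.range fun p : ℕ × ℕ => x n e m P ^ p.1 * monomial n e m P p.2) = ⊤ := by
  set V := Submodule.span k
    (Set.range fun p : ℕ × ℕ => x n e m P ^ p.1 * monomial n e m P p.2) with hV
  set X := x n e m P
  set Y := y n e m P
  set Z := z n e m P
  set S := s n e m P with hS
  set d := P.natDegree
  have hS' : Y ^ m = S + X ^ e * Z := by rw [hS, s]; ring
  have hrel : S ^ d = X ^ n * Y -
      ∑ i ∈ Finset.range d, Polynomial.aeval X (P.coeff i) * S ^ i := by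
    rw [relation, evalXS_monic hP]
    ring
  have gen : ∀ {a b : ℕ}, a < d → b < m → ∀ l, S ^ a * Y ^ b * Z ^ l ∈ V := by
    intro a b ha hb l
    refine Submodule.subset_span ⟨(0, a + d * (b + m * l)), ?_⟩
    simp only [pow_zero, one_mul]
    exact exists_monomial_eq (by lia) (by lia) ha hb l
  -- Stability under multiplication by `r` needs checking only on the spanning products.
  have closure : ∀ r : RRing n e m P, (∀ i a b l, a < d → b < m →
      r * (X ^ i * (S ^ a * Y ^ b * Z ^ l)) ∈ V) → ∀ v ∈ V, r * v ∈ V := by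
    intro r hr v hv
    induction hv using Submodule.span_induction with
    | mem v h =>
      obtain ⟨p, rfl⟩ := h
      exact hr _ _ _ _ (Nat.mod_lt _ (by lia)) (Nat.mod_lt _ (by lia))
    | zero => simp
    | add u v _ _ hu hv => rw [mul_add]; exact add_mem hu hv
    | smul c v _ hv => rw [mul_smul_comm]; exact Submodule.smul_mem _ _ hv
  have hX : ∀ v ∈ V, X * v ∈ V := by
    refine closure X fun i a b l ha hb => ?_
    refine Submodule.subset_span ⟨(i + 1, a + d * (b + m * l)), ?_⟩
    simp only
    rw [exists_monomial_eq (by lia) (by lia) ha hb l]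
    ring
  have hXp : ∀ i, ∀ v ∈ V, X ^ i * v ∈ V := by
    intro i v hv
    simpa using aeval_mul_mem hX (Polynomial.X ^ i) hv
  have hZ : ∀ v ∈ V, Z * v ∈ V := by
    refine closure Z fun i a b l ha hb => ?_
    convert hXp i _ (gen ha hb (l + 1)) using 1
    ring
  have hZp : ∀ i, ∀ v ∈ V, Z ^ i * v ∈ V := by
    intro i v hv
    simpa using aeval_mul_mem hZ (Polynomial.X ^ i) hv
  have gen0 : ∀ {a b : ℕ}, a < d → b < m → S ^ a * Y ^ b ∈ V := fun ha hb => by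
    simpa using gen ha hb 0
  have hSd : ∀ b < m, S ^ d * Y ^ b ∈ V := by
    intro b hb
    rw [hrel, sub_mul, Finset.sum_mul]
    refine sub_mem ?_ (sum_mem fun i hi => ?_)
    · rw [mul_assoc]
      refine hXp _ _ ?_
      rw [← pow_succ']
      rcases Nat.lt_or_ge (b + 1) m with h | h
      · simpa using gen0 (a := 0) (by lia) h
      · rw [show b + 1 = m by lia, hS']
        refine add_mem ?_ (hXp _ _ ?_)
        · simpa using gen0 (a := 1) (b := 0) (by lia) (by lia)
        · simpa using gen (a := 0) (b := 0) (by lia) (by lia) 1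
    · rw [mul_assoc]
      exact aeval_mul_mem hX _ (gen0 (Finset.mem_range.1 hi) hb)
  have hSY : ∀ a b, a ≤ d → b < m → S ^ a * Y ^ b ∈ V := by
    intro a b ha hb
    rcases ha.lt_or_eq with h | rfl
    · exact gen0 h hb
    · exact hSd b hb
  have hSY' : ∀ a, a < d → S ^ a * Y ^ m ∈ V := by
    intro a ha
    rw [hS', mul_add, ← pow_succ]
    refine add_mem ?_ ?_
    · simpa using hSY (a + 1) 0 ha (by lia)
    · rw [mul_left_comm]
      refine hXp _ _ ?_
      simpa using gen (b := 0) ha (by lia) 1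
  have hYm : ∀ v ∈ V, Y * v ∈ V := by
    refine closure Y fun i a b l ha hb => ?_
    have h : S ^ a * Y ^ (b + 1) ∈ V := by
      rcases Nat.lt_or_ge (b + 1) m with h | h
      · exact gen0 ha h
      · rw [show b + 1 = m by lia]
        exact hSY' a ha
    convert hXp i _ (hZp l _ h) using 1
    ring
  rw [eq_top_iff]
  rintro a -
  have ha : a ∈ Algebra.adjoin k {X, Y, Z} := by rw [adjoin_eq_top]; trivial
  have key : ∀ v ∈ V, a * v ∈ V := by
    induction ha using Algebra.adjoin_induction with
    | mem a h =>
      obtain rfl | rfl | rfl := h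
      exacts [hX, hYm, hZ]
    | algebraMap r =>
      intro v hv
      rw [← Algebra.smul_def]
      exact Submodule.smul_mem _ _ hv
    | add a b _ _ ha hb =>
      intro v hv
      rw [add_mul]
      exact add_mem (ha v hv) (hb v hv)
    | mul a b _ _ ha hb =>
      intro v hv
      rw [mul_assoc]
      exact ha _ (hb v hv)
  simpa using key 1 (by simpa using gen (a := 0) (b := 0) (by lia) (by lia) 0)

variable (n e m P) in
/-- The elements of `R_{n,e,P}` of degree at most `N` in `s`. -/
def degFil (N : ℤ) : Submodule k (RRing n e m P) :=
  (degLE k N).comap (toLaurent n e m P).toLinearMap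

theorem mem_degFil {N : ℤ} {a : RRing n e m P} :
    a ∈ degFil n e m P N ↔ ∀ g : ℤ × ℤ, N < g.1 → (toLaurent n e m P a).coeff g = 0 := Iff.rfl

theorem degFil_mono {M N : ℤ} (h : M ≤ N) : degFil n e m P M ≤ degFil n e m P N :=
  Submodule.comap_mono (degLE_mono h)

/-- The leading exponents `(N, i - pole N)` of the elements `x ^ i * monomial N` are pairwise
distinct, so a linear combination has the largest degree occurring in it. -/
theorem degFil_eq_span (hP : P.Monic) (hd : 2 ≤ P.natDegree) (hm : 2 ≤ m) (N : ℤ) :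
    degFil n e m P N = Submodule.span k ((fun p : ℕ × ℕ => x n e m P ^ p.1 *
      monomial n e m P p.2) '' {p | (p.2 : ℤ) ≤ N}) := by
  refine le_antisymm (fun a ha => ?_) (Submodule.span_le.2 ?_)
  · have h : a ∈ Submodule.span k (Set.range fun p : ℕ × ℕ =>
        x n e m P ^ p.1 * monomial n e m P p.2) := by
      rw [span_monomial hP hd hm]; trivial
    obtain ⟨l, rfl⟩ := Finsupp.mem_span_range_iff_exists_finsupp.1 h
    refine sum_mem fun p hp => Submodule.smul_mem _ _ (Submodule.subset_span ⟨p, ?_, rfl⟩)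
    obtain ⟨q, hq, hmax⟩ := Finset.exists_max_image l.support (fun p => p.2) ⟨p, hp⟩
    refine (Int.ofNat_le.2 (hmax p hp)).trans ?_
    by_contra hlt
    rw [not_le] at hlt
    -- At the leading exponent of a term `q` of maximal degree no other term contributes, so the
    -- coefficient of `q` would vanish.
    have h0 := ha (q.2, q.1 - pole n e m P.natDegree q.2) hlt
    rw [AlgHom.toLinearMap_apply, Finsupp.sum, map_sum, AddMonoidAlgebra.coeff_sum,
      Finsupp.finsetSum_apply, Finset.sum_eq_single q] at h0
    · rw [map_smul, AddMonoidAlgebra.coeff_smul, Finsupp.smul_apply,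
        (hasLead_x_pow_mul_monomial hP hd hm q.1 q.2).coeff, if_pos rfl] at h0
      exact Finsupp.mem_support_iff.1 hq (by simpa using h0)
    · intro r hr hne
      rw [map_smul, AddMonoidAlgebra.coeff_smul, Finsupp.smul_apply]
      rcases (hmax r hr).lt_or_eq with h1 | h1
      · rw [(hasLead_x_pow_mul_monomial hP hd hm r.1 r.2).mem_degLE _ (by simpa using h1),
          smul_zero]
      · rw [← h1, (hasLead_x_pow_mul_monomial hP hd hm r.1 r.2).coeff, if_neg, smul_zero]
        intro h2
        exact hne (Prod.ext (by lia) h1)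
    · intro hq'
      exact absurd hq hq'
  · rintro _ ⟨p, hp, rfl⟩
    exact degLE_mono hp (hasLead_x_pow_mul_monomial hP hd hm p.1 p.2).mem_degLE

/-- An element of the kernel has degree at most `-1`, and no spanning product has negative degree.
-/
theorem toLaurent_injective (hP : P.Monic) (hd : 2 ≤ P.natDegree) (hm : 2 ≤ m) :
    Function.Injective (toLaurent n e m P) := by
  refine (injective_iff_map_eq_zero _).2 fun a ha => ?_
  have h : a ∈ degFil n e m P (-1) := by
    intro g _
    rw [AlgHom.toLinearMap_apply, ha]
    rfl
  rw [degFil_eq_span hP hd hm] at h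
  convert h using 1
  have : {p : ℕ × ℕ | (p.2 : ℤ) ≤ -1} = ∅ := by
    ext p
    simp
    lia
  simp [this]

/-- Modulo lower degree, an element of degree at most `N` is a `k[x]`-multiple of the single product
of degree `N`, whose leading coefficient is `x ^ (-pole N)`. -/
theorem coeff_toLaurent_eq_zero (hP : P.Monic) (hd : 2 ≤ P.natDegree) (hm : 2 ≤ m) {N : ℕ}
    {a : RRing n e m P} (ha : a ∈ degFil n e m P N) {c : ℤ}
    (hc : c < -pole n e m P.natDegree N) : (toLaurent n e m P a).coeff (N, c) = 0 := by
  rw [degFil_eq_span hP hd hm] at ha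
  induction ha using Submodule.span_induction with
  | mem a h =>
    obtain ⟨p, hp, rfl⟩ := h
    rcases (Int.ofNat_le.1 hp).lt_or_eq with h1 | h1
    · exact (hasLead_x_pow_mul_monomial hP hd hm p.1 p.2).mem_degLE _ (by simpa using h1)
    · rw [← h1, (hasLead_x_pow_mul_monomial hP hd hm p.1 p.2).coeff, if_neg]
      rw [h1]
      lia
  | zero => simp
  | add a b _ _ ha hb => simp [ha, hb]
  | smul r a _ ha => simp [ha]

theorem eq_zero_of_mem_degFil_neg (hP : P.Monic) (hd : 2 ≤ P.natDegree) (hm : 2 ≤ m) {N : ℤ}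
    (hN : N < 0) {a : RRing n e m P} (ha : a ∈ degFil n e m P N) : a = 0 := by
  rw [degFil_eq_span hP hd hm] at ha
  have : {p : ℕ × ℕ | (p.2 : ℤ) ≤ N} = ∅ := by
    ext p
    simp
    lia
  simpa [this] using ha

end RRing

/-! ### Derivations, and the basic derivation `x ^ (n + e) * d/ds` -/

theorem evalXS_mem {A : Type*} [CommRing A] [Algebra k A] {S : Subalgebra k A} {x s : A}
    (hx : x ∈ S) (hs : s ∈ S) (P : Polynomial (Polynomial k)) : evalXS P x s ∈ S := by
  have h := map_evalXS S.val P ⟨x, hx⟩ ⟨s, hs⟩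
  simp only [Subalgebra.coe_val] at h
  rw [← h]
  exact Subtype.prop _

theorem Derivation.map_evalXS {A : Type*} [CommRing A] [Algebra k A] (D : Derivation k A A)
    {x : A} (hx : D x = 0) (s : A) (P : Polynomial (Polynomial k)) :
    D (evalXS P x s) = evalXS (Polynomial.derivative P) x s * D s := by
  induction P using Polynomial.induction_on' with
  | add p q hp hq =>
    simp only [evalXS, Polynomial.eval₂_add, map_add] at hp hq ⊢
    rw [hp, hq, add_mul]
  | monomial i f =>
    have hf : D (Polynomial.aeval x f) = 0 := by
      induction f using Polynomial.induction_on' with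
      | add p q hp hq => rw [map_add, map_add, hp, hq, add_zero]
      | monomial j r =>
        rw [Polynomial.aeval_monomial, D.leibniz, D.leibniz_pow, hx, D.map_algebraMap]
        simp
    have hf' : D ((Polynomial.aeval x : Polynomial k →ₐ[k] A).toRingHom f) = 0 := hf
    have hi : (Polynomial.aeval x : Polynomial k →ₐ[k] A).toRingHom (i : Polynomial k) = i :=
      _root_.map_natCast (Polynomial.aeval x : Polynomial k →ₐ[k] A).toRingHom i
    rw [Polynomial.derivative_monomial, evalXS, evalXS, Polynomial.eval₂_monomial,
      Polynomial.eval₂_monomial, D.leibniz, D.leibniz_pow, hf', map_mul, hi]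
    simp only [smul_eq_mul, nsmul_eq_mul]
    ring

/-- The exponent `n + e` pays for two divisions: by `x ^ n` in differentiating the relation for `y`,
then by `x ^ e` in differentiating the one for `z`. The values thus stay polynomial in the
generators. -/
theorem Derivation.map_of_relation {A : Type*} [CommRing A] [IsDomain A] [Algebra k A]
    (D : Derivation k A A) {n e m : ℕ} {P : Polynomial (Polynomial k)} {x y z s : A} (hx0 : x ≠ 0)
    (hx : D x = 0) (hs : D s = x ^ (n + e)) (hy : x ^ n * y = evalXS P x s)
    (hz : x ^ e * z = y ^ m - s) :
    D y = x ^ e * evalXS (Polynomial.derivative P) x s ∧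
    D z = (m : A) * y ^ (m - 1) * evalXS (Polynomial.derivative P) x s - x ^ n := by
  have hxp : ∀ i : ℕ, D (x ^ i) = 0 := fun i => by rw [D.leibniz_pow, hx]; simp
  have hDy : D y = x ^ e * evalXS (Polynomial.derivative P) x s := by
    have h := congrArg D hy
    rw [D.leibniz, hxp, D.map_evalXS hx, hs, smul_zero, add_zero, smul_eq_mul] at h
    refine mul_left_cancel₀ (pow_ne_zero n hx0) (h.trans ?_)
    ring
  refine ⟨hDy, ?_⟩
  have h := congrArg D hz
  rw [D.leibniz, hxp, map_sub, D.leibniz_pow, hs, hDy, smul_zero, add_zero, smul_eq_mul,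
    smul_eq_mul, nsmul_eq_mul] at h
  refine mul_left_cancel₀ (pow_ne_zero e hx0) (h.trans ?_)
  ring

/-- A derivation restricts to a subalgebra when it maps generators of it into it. -/
theorem Derivation.exists_restrict {A C : Type*} [CommRing A] [Algebra k A] [CommRing C]
    [Algebra k C] {ι : C →ₐ[k] A} (hι : Function.Injective ι) (D : Derivation k A A) {G : Set C}
    (hG : Algebra.adjoin k G = ⊤) (h : ∀ g ∈ G, D (ι g) ∈ ι.range) :
    ∃ D₀ : Derivation k C C, ∀ c, D (ι c) = ι (D₀ c) := by
  have key : ∀ c : C, D (ι c) ∈ ι.range := by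
    intro c
    have hc : c ∈ Algebra.adjoin k G := by rw [hG]; trivial
    induction hc using Algebra.adjoin_induction with
    | mem c hc => exact h c hc
    | algebraMap r => rw [AlgHom.commutes, D.map_algebraMap]; exact zero_mem _
    | add a b _ _ ha hb => rw [map_add, map_add]; exact add_mem ha hb
    | mul a b _ _ ha hb =>
      rw [map_mul, D.leibniz]
      exact add_mem (mul_mem ⟨a, rfl⟩ hb) (mul_mem ⟨b, rfl⟩ ha)
  choose f hf using key
  have hf' : ∀ c, ι (f c) = D (ι c) := hf
  let F : C →ₗ[k] C :=
    { toFun := f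
      map_add' := fun a b => hι (by rw [hf', map_add, map_add, map_add, hf', hf'])
      map_smul' := fun r a => hι (by
        rw [hf', _root_.map_smul, D.map_smul, RingHom.id_apply, _root_.map_smul, hf']) }
  refine ⟨Derivation.mk' F fun a b => hι ?_, fun c => (hf' c).symm⟩
  change ι (f (a * b)) = ι (a * f b + b * f a)
  rw [hf', map_mul, D.leibniz, map_add, map_mul, map_mul, hf', hf']
  rfl

namespace RRing

variable {n e m : ℕ} {P : Polynomial (Polynomial k)}

/-- A derivation along a homomorphism into a domain vanishes if it kills `x` and `s`. -/
theorem derivation_eq_zero {B : Type*} [CommRing B] [IsDomain B] [Algebra k B]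
    (ι : RRing n e m P →ₐ[k] B) (hι : ι (x n e m P) ≠ 0) (δ : RRing n e m P →ₗ[k] B)
    (hδ : ∀ a b, δ (a * b) = ι a * δ b + ι b * δ a) (hx : δ (x n e m P) = 0)
    (hs : δ (s n e m P) = 0) : δ = 0 := by
  have h1 : δ 1 = 0 := by simpa using hδ 1 1
  let K : Subalgebra k (RRing n e m P) :=
    { carrier := {a | δ a = 0}
      mul_mem' := fun {a b} ha hb => by
        have ha : δ a = 0 := ha
        have hb : δ b = 0 := hb
        change δ _ = 0
        rw [hδ, ha, hb, mul_zero, mul_zero, add_zero]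
      add_mem' := fun {a b} ha hb => by
        have ha : δ a = 0 := ha
        have hb : δ b = 0 := hb
        change δ _ = 0
        rw [map_add, ha, hb, add_zero]
      algebraMap_mem' := fun r => by
        change δ _ = 0
        rw [Algebra.algebraMap_eq_smul_one, map_smul, h1, smul_zero] }
  have hxK : x n e m P ∈ K := hx
  have hsK : s n e m P ∈ K := hs
  have hdiv : ∀ (i : ℕ) (a : RRing n e m P), x n e m P ^ i * a ∈ K → a ∈ K := by
    intro i a h
    have h2 : δ (x n e m P ^ i) = 0 := pow_mem hxK i
    have h3 : δ (x n e m P ^ i * a) = 0 := h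
    rw [hδ, h2, mul_zero, add_zero, map_pow] at h3
    exact (mul_eq_zero.1 h3).resolve_left (pow_ne_zero _ hι)
  have hyK : y n e m P ∈ K := hdiv n _ (by rw [relation]; exact evalXS_mem hxK hsK P)
  have hzK : z n e m P ∈ K := by
    refine hdiv e _ ?_
    have : x n e m P ^ e * z n e m P = y n e m P ^ m - s n e m P := by rw [s]; ring
    rw [this]
    exact sub_mem (pow_mem hyK m) hsK
  have hK : (⊤ : Subalgebra k (RRing n e m P)) ≤ K := by
    rw [← adjoin_eq_top, Algebra.adjoin_le_iff]
    rintro a (rfl | rfl | rfl)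
    exacts [hxK, hyK, hzK]
  refine LinearMap.ext fun a => ?_
  exact hK (Algebra.mem_top (R := k) (x := a))

end RRing

namespace Laurent2

/-- The derivation `S * d/dS`. -/
def eulerS (k : Type*) [Field k] : Derivation k (Laurent2 k) (Laurent2 k) :=
  euler ((Int.castAddHom k).comp (AddMonoidHom.fst ℤ ℤ))

/-- The derivation `X * d/dX`. -/
def eulerX (k : Type*) [Field k] : Derivation k (Laurent2 k) (Laurent2 k) :=
  euler ((Int.castAddHom k).comp (AddMonoidHom.snd ℤ ℤ))

theorem coeff_eulerS (f : Laurent2 k) (g : ℤ × ℤ) :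
    (eulerS k f).coeff g = g.1 * f.coeff g := coeff_euler _ _ _

theorem coeff_eulerX (f : Laurent2 k) (g : ℤ × ℤ) :
    (eulerX k f).coeff g = g.2 * f.coeff g := coeff_euler _ _ _

theorem eulerS_mono (a b : ℤ) : eulerS k (mono a b) = (a : k) • mono a b := euler_mono _ _ _

theorem eulerX_mono (a b : ℤ) : eulerX k (mono a b) = (b : k) • mono a b := euler_mono _ _ _

end Laurent2

namespace RRing

variable {n e m : ℕ} {P : Polynomial (Polynomial k)}

variable (n e m P) in
theorem exists_derivation (hP : P.Monic) (hd : 2 ≤ P.natDegree) (hm : 2 ≤ m) :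
    ∃ D : Derivation k (RRing n e m P) (RRing n e m P), ∀ a,
      toLaurent n e m P (D a) = mono (-1) (n + e) * eulerS k (toLaurent n e m P a) := by
  set E : Derivation k (Laurent2 k) (Laurent2 k) := (mono (-1) (n + e) : Laurent2 k) • eulerS k
    with hE
  have hEa : ∀ f, E f = mono (-1) (n + e) * eulerS k f := fun f => rfl
  have hx : E (mono 0 1) = 0 := by rw [hEa, eulerS_mono]; simp
  have hs : E (mono 1 0) = mono 0 1 ^ (n + e) := by
    rw [hEa, eulerS_mono, mono_pow, Int.cast_one, one_smul, mono_mul]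
    congr 1
    simp
  obtain ⟨hy, hz⟩ := E.map_of_relation (mono_ne_zero 0 1) hx hs
    (mono_mul_yLaurent (n := n) (P := P)) (mono_mul_zLaurent (n := n) (e := e) (m := m) (P := P))
  obtain ⟨D, hD⟩ := E.exists_restrict (toLaurent_injective (n := n) (e := e) hP hd hm)
    adjoin_eq_top (by
      rintro g (rfl | rfl | rfl)
      · rw [toLaurent_x, hx]
        exact zero_mem _
      · rw [toLaurent_y, hy]
        refine ⟨x n e m P ^ e * evalXS (Polynomial.derivative P) (x n e m P) (s n e m P), ?_⟩
        simp only [AlgHom.toRingHom_eq_coe, RingHom.coe_coe]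
        rw [map_mul, map_pow, _root_.map_evalXS, toLaurent_x, toLaurent_s]
      · rw [toLaurent_z, hz]
        refine ⟨(m : RRing n e m P) * y n e m P ^ (m - 1) * evalXS (Polynomial.derivative P) (x n e m P)
          (s n e m P) - x n e m P ^ n, ?_⟩
        simp only [AlgHom.toRingHom_eq_coe, RingHom.coe_coe]
        rw [map_sub, map_mul, map_mul, map_natCast, map_pow, map_pow, _root_.map_evalXS,
          toLaurent_x, toLaurent_s, toLaurent_y])
  exact ⟨D, fun a => (hD a).symm⟩

/-- `D` is the derivation `x ^ (n + e) * d/ds` of `R_{n,e,P}`. -/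
def IsBasicDerivation (D : Derivation k (RRing n e m P) (RRing n e m P)) : Prop :=
  ∀ a, toLaurent n e m P (D a) = mono (-1) (n + e) * eulerS k (toLaurent n e m P a)

namespace IsBasicDerivation

variable {D : Derivation k (RRing n e m P) (RRing n e m P)} (hD : IsBasicDerivation D)
include hD

theorem coeff (a : RRing n e m P) (N c : ℤ) : (toLaurent n e m P (D a)).coeff (N, c) =
    (N + 1) * (toLaurent n e m P a).coeff (N + 1, c - (n + e)) := by
  rw [hD, coeff_mono_mul, coeff_eulerS]
  simp

theorem coeff_iterate (r : ℕ) (a : RRing n e m P) (N c : ℤ) :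
    (toLaurent n e m P (D^[r] a)).coeff (N, c) = (∏ i ∈ Finset.range r, ((N : k) + 1 + i)) *
      (toLaurent n e m P a).coeff (N + r, c - r * (n + e)) := by
  induction r generalizing a with
  | zero => simp
  | succ r ih =>
    rw [Function.iterate_succ_apply, ih, hD.coeff, Finset.prod_range_succ]
    push_cast
    ring_nf

theorem map_mem_degFil {N : ℤ} {a : RRing n e m P} (ha : a ∈ degFil n e m P N) :
    D a ∈ degFil n e m P (N - 1) := by
  rintro ⟨M, c⟩ hM
  simp only at hM
  rw [AlgHom.toLinearMap_apply, hD.coeff, mem_degFil.1 ha _ (by simp only; lia), mul_zero]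

/-- In characteristic zero `d/ds` lowers every positive degree by exactly one: the integer factors
in `coeff_iterate` do not vanish. The bound `r - 1` is an integer, so `r = 0` gives the zero space.
-/
theorem iterate_eq_zero_iff [CharZero k] (hP : P.Monic) (hd : 2 ≤ P.natDegree) (hm : 2 ≤ m)
    (r : ℕ) (a : RRing n e m P) : D^[r] a = 0 ↔ a ∈ degFil n e m P (r - 1) := by
  constructor
  · rintro h ⟨N, c⟩ hN
    simp only at hN
    obtain ⟨M, rfl⟩ : ∃ M : ℕ, N = M + r := ⟨(N - r).toNat, by lia⟩
    have h1 := hD.coeff_iterate r a M (c + r * (n + e))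
    rw [h, add_sub_cancel_right, map_zero] at h1
    refine (mul_eq_zero.1 h1.symm).resolve_left (Finset.prod_ne_zero_iff.2 fun i _ => ?_)
    rw [Int.cast_natCast]
    norm_cast
    lia
  · intro h
    have key : ∀ i : ℕ, D^[i] a ∈ degFil n e m P (r - 1 - i) := by
      intro i
      induction i with
      | zero => simpa using h
      | succ i ih =>
        rw [Function.iterate_succ_apply']
        have := hD.map_mem_degFil ih
        push_cast
        rwa [← sub_sub]
    exact eq_zero_of_mem_degFil_neg hP hd hm (by lia) (key r)

theorem map_x (hP : P.Monic) (hd : 2 ≤ P.natDegree) (hm : 2 ≤ m) : D (x n e m P) = 0 := by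
  refine toLaurent_injective hP hd hm ?_
  rw [hD, toLaurent_x, eulerS_mono]
  simp

theorem map_s (hP : P.Monic) (hd : 2 ≤ P.natDegree) (hm : 2 ≤ m) :
    D (s n e m P) = x n e m P ^ (n + e) := by
  refine toLaurent_injective hP hd hm ?_
  rw [hD, toLaurent_s, eulerS_mono, map_pow, toLaurent_x, mono_pow, Int.cast_one, one_smul,
    mono_mul]
  congr 1
  simp

end IsBasicDerivation

theorem exists_mem_degFil (a : RRing n e m P) : ∃ N : ℕ, a ∈ degFil n e m P N := by
  refine ⟨(toLaurent n e m P a).coeff.support.sup fun g => g.1.toNat, fun g hg => ?_⟩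
  by_contra h
  have := Finset.le_sup (f := fun g : ℤ × ℤ => g.1.toNat) (Finsupp.mem_support_iff.2 h)
  rw [AlgHom.toLinearMap_apply] at this
  lia

end RRing

/-! ### Arithmetic excluding leading shifts of nonnegative degree -/

namespace RRing

theorem pole_add {n e m d a b l : ℕ} (ha : a < d) (hb : b < m) :
    pole n e m d (a + d * (b + m * l)) = n * b + (n * m + e) * l := by
  have hd : 0 < d := by lia
  have hm : 0 < m := by lia
  rw [pole, Nat.add_mul_div_left _ _ hd, Nat.div_eq_of_lt ha, zero_add, Nat.add_mul_mod_self_left,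
    Nat.mod_eq_of_lt hb, Nat.add_mul_div_left _ _ hm, Nat.div_eq_of_lt hb, zero_add]

/-- Eliminating `B` from the two inequalities leaves `m * d * n + e * (m * d - 1) < m * d + n * m`.
This fails when `2 ≤ n` or `1 ≤ e`, but holds for `(n, e) = (1, 0)`. -/
theorem no_root_aux {n e m d A B : ℤ} (hm : 2 ≤ m) (hd : 2 ≤ d) (hn : 1 ≤ n) (he : 0 ≤ e)
    (hA : 1 ≤ A) (hne : 2 ≤ n ∨ 1 ≤ e) (h2 : (n * m + e) * A ≤ m * d * B)
    (h3 : B * (m * d) + 1 ≤ A * (n * (m - 1) + 1) + B) : False := by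
  have hmd : 4 ≤ m * d := by nlinarith
  have h8 : (n * m + e) * A * (m * d - 1) ≤ m * d * B * (m * d - 1) :=
    mul_le_mul_of_nonneg_right h2 (by lia)
  have h9 : m * d * (B * (m * d) + 1) ≤ m * d * (A * (n * (m - 1) + 1) + B) :=
    mul_le_mul_of_nonneg_left h3 (by lia)
  have h4 : A * ((n * m + e) * (m * d - 1)) < A * (m * d * (n * (m - 1) + 1)) := by linarith
  have h5 := lt_of_mul_lt_mul_left h4 (by lia)
  have h6 : m * d * n + e * (m * d - 1) < m * d + n * m := by linarith
  rcases hne with hn2 | he1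
  · have h7 : 0 ≤ e * (m * d - 1) := mul_nonneg he (by lia)
    have h10 : m * (d * n) < m * (d + n) := by linarith
    have := lt_of_mul_lt_mul_left h10 (by lia)
    nlinarith
  · have h7 : 1 * (m * d - 1) ≤ e * (m * d - 1) := mul_le_mul_of_nonneg_right he1 (by lia)
    have h10 : n * m * 2 ≤ n * m * d := mul_le_mul_of_nonneg_left hd (by positivity)
    have h11 : 1 * m ≤ n * m := mul_le_mul_of_nonneg_right hn (by lia)
    have h12 : n * m * d = m * d * n := by ring
    lia

/-- Here `(v, u)` is the shift `Δ`, and `A`, `B` are the weights of `x`, `s` for the linear form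
normalized so that `Δ` has weight `-1`. The hypothesis `h2` says that `z` has nonnegative weight;
`hx`, `hs`, `hy` say that the shifted exponents of `x`, `s`, `y` respect the bound on poles whenever
the weight in question is nonzero. -/
theorem no_positive_root {n e m d A B v : ℕ} {u : ℤ} (hd : 2 ≤ d) (hm : 2 ≤ m) (hn : 1 ≤ n)
    (hne : (n, e) ≠ (1, 0)) (h1 : A * u + B * v = -1) (h2 : (n * m + e) * A ≤ m * d * B)
    (hx : A ≠ 0 → -(pole n e m d v : ℤ) ≤ 1 + u)
    (hs : B ≠ 0 → -(pole n e m d (v + 1) : ℤ) ≤ u)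
    (hy : d * B ≠ n * A → -(pole n e m d (v + d) : ℤ) ≤ u - n) : False := by
  have hA : A ≠ 0 := by
    rintro rfl
    simp at h1
    have : (0 : ℤ) ≤ B * v := by positivity
    lia
  have hA1 : 1 ≤ A := by lia
  have hnm : 0 < n * m := by positivity
  have hB : B ≠ 0 := by
    rintro rfl
    have : 0 < (n * m + e) * A := by positivity
    lia
  specialize hx hA
  specialize hs hB
  obtain ⟨p, rfl⟩ : ∃ p : ℕ, u = -p := by
    refine ⟨(-u).toNat, ?_⟩
    have : u < 0 := by
      by_contra hu
      have h3 : 0 ≤ (A : ℤ) * u := mul_nonneg (by positivity) (by lia)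
      have : (0 : ℤ) ≤ B * v := by positivity
      lia
    lia
  have h1' : A * p = B * v + 1 := by
    zify
    linarith
  obtain ⟨a, b, l, ha, hb, rfl⟩ : ∃ a b l, a < d ∧ b < m ∧ v = a + d * (b + m * l) :=
    ⟨v % d, v / d % m, v / d / m, Nat.mod_lt _ (by lia), Nat.mod_lt _ (by lia), by
      rw [Nat.mod_add_div, Nat.mod_add_div]⟩
  rw [pole_add ha hb] at hx
  -- `hx` gives `p ≤ pole v + 1`. Conversely `pole v` is at most `(n * m + e) * v / (m * d)`, which
  -- by `h2` and `h1'` is less than `p`.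
  have hp : p = n * b + (n * m + e) * l + 1 := by
    refine le_antisymm (by lia) (Nat.succ_le_of_lt ?_)
    have h3 : m * d * (n * b + (n * m + e) * l) ≤ (n * m + e) * (a + d * (b + m * l)) := by
      have : (n * m + e) * (a + d * (b + m * l)) = m * d * (n * b + (n * m + e) * l) +
        ((n * m + e) * a + e * d * b) := by ring
      lia
    have h4 : A * (m * d * (n * b + (n * m + e) * l)) < A * (m * d * p) := calc
      _ ≤ A * ((n * m + e) * (a + d * (b + m * l))) := Nat.mul_le_mul_left _ h3
      _ = ((n * m + e) * A) * (a + d * (b + m * l)) := by ring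
      _ ≤ (m * d * B) * (a + d * (b + m * l)) := Nat.mul_le_mul_right _ h2
      _ < (m * d * B) * (a + d * (b + m * l)) + m * d := by
        have : 0 < m * d := by positivity
        lia
      _ = m * d * (B * (a + d * (b + m * l)) + 1) := by ring
      _ = _ := by rw [← h1']; ring
    exact lt_of_mul_lt_mul_left' (lt_of_mul_lt_mul_left' h4)
  -- By `hs` the pole must grow from `v` to `v + 1`, which happens only if the last digit of `v` is
  -- `d - 1`.
  have ha' : a + 1 = d := by
    by_contra h
    rw [show a + d * (b + m * l) + 1 = (a + 1) + d * (b + m * l) by ring,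
      pole_add (by lia) hb] at hs
    lia
  rcases Nat.lt_or_ge (b + 1) m with hb' | hb'
  · rw [show a + d * (b + m * l) + d = a + d * (b + 1 + m * l) by ring, pole_add ha hb'] at hy
    -- From `v` to `v + d` the pole grows by only `n`, one less than `hy` would require, so `y` has
    -- weight zero.
    have hdB : d * B = n * A := by
      by_contra h
      have := hy h
      push_cast at this
      rw [hp] at this
      push_cast at this
      nlinarith
    have he : e = 0 := by
      have : m * d * B = n * m * A := by
        rw [mul_assoc, hdB]
        ring
      rw [this, add_mul] at h2
      have : e * A ≤ 0 := by lia
      rcases Nat.mul_eq_zero.1 (Nat.le_zero.1 this) with h | h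
      · exact h
      · exact absurd h hA
    subst he
    have hn2 : 2 ≤ n := by
      by_contra h
      exact hne (by rw [show n = 1 by lia])
    have h5 : A = B * a + 1 := by
      rw [hp] at h1'
      have h6 : A * (n * b + (n * m + 0) * l + 1) = n * A * (b + m * l) + A := by ring
      have h7 : B * (a + d * (b + m * l)) + 1 = d * B * (b + m * l) + (B * a + 1) := by ring
      rw [h6, h7, hdB] at h1'
      lia
    have h6 : d * A = n * A * a + d := by
      rw [← hdB]
      conv_lhs => rw [h5]
      ring
    -- As `d = a + 1` with `1 ≤ a`, one has `d ≤ 2 * a ≤ n * a`, against `h6`.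
    have h7 : d * A ≤ n * A * a := calc
      d * A ≤ (2 * a) * A := Nat.mul_le_mul_right _ (by lia)
      _ = 2 * (A * a) := by ring
      _ ≤ n * (A * a) := Nat.mul_le_mul_right _ hn2
      _ = _ := by ring
    lia
  · obtain rfl : m = b + 1 := by lia
    subst ha'
    -- In the remaining case the digits of `v` are `a = d - 1` and `b = m - 1`. The part of `h1'`
    -- that depends on `l` is removed using `h2`.
    have h3 : B * ((b + 1) * (a + 1)) + 1 ≤ A * (n * b + 1) + B := by
      have h4 : A * p = A * (n * b + 1) + (n * (b + 1) + e) * A * l := by rw [hp]; ring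
      have h5 : B * (a + (a + 1) * (b + (b + 1) * l)) + 1 + B =
        (b + 1) * (a + 1) * B * l + (B * ((b + 1) * (a + 1)) + 1) := by ring
      have h6 : (n * (b + 1) + e) * A * l ≤ (b + 1) * (a + 1) * B * l :=
        Nat.mul_le_mul_right _ h2
      lia
    refine no_root_aux (n := n) (e := e) (m := b + 1) (d := a + 1) (A := A) (B := B)
      (by exact_mod_cast hm) (by exact_mod_cast hd) (by exact_mod_cast hn) (by positivity)
      (by exact_mod_cast hA1) ?_ (by exact_mod_cast h2) ?_
    · rcases Nat.eq_zero_or_pos e with rfl | he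
      · left
        by_contra h
        exact hne (by rw [show n = 1 by lia])
      · right
        exact_mod_cast he
    · rw [add_sub_cancel_right]
      exact_mod_cast h3

/-- The exponents `(N, c)` of the leading terms of elements of `R_{n,e,P}`. -/
def IsLeadExponent (n e m d : ℕ) (w : ℤ × ℤ) : Prop :=
  0 ≤ w.1 ∧ -(pole n e m d w.1.toNat : ℤ) ≤ w.2

/-- `hnil` expresses local nilpotency on leading terms, and `hshift` says that a nonzero leading
term of `D a` is again that of an element of `R`. If `0 ≤ Δ.1`, dividing `l` by `-l Δ` gives
nonnegative integer weights and leads to `no_positive_root`. -/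
theorem shift_fst_neg {k : Type*} [Field k] [CharZero k] {n e m d : ℕ} (hd : 2 ≤ d) (hm : 2 ≤ m)
    (hn : 1 ≤ n) (hne : (n, e) ≠ (1, 0)) {l : ℤ × ℤ →+ k} (hl : l ≠ 0) {Δ : ℤ × ℤ}
    (hnil : ∀ w, IsLeadExponent n e m d w → ∃ r, ∏ i ∈ Finset.range r, l (w + i • Δ) = 0)
    (hshift : ∀ w, IsLeadExponent n e m d w → l w ≠ 0 → IsLeadExponent n e m d (w + Δ)) :
    Δ.1 < 0 := by
  by_contra! hΔ
  have hmul : ∀ w, IsLeadExponent n e m d w → ∃ i : ℕ, l w = -(i * l Δ) := by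
    intro w hw
    obtain ⟨r, hr⟩ := hnil w hw
    obtain ⟨i, -, hi⟩ := Finset.prod_eq_zero_iff.1 hr
    refine ⟨i, ?_⟩
    rw [map_add, map_nsmul, nsmul_eq_mul] at hi
    exact eq_neg_of_add_eq_zero_left hi
  have hform : ∀ w : ℤ × ℤ, l w = w.1 * l (1, 0) + w.2 * l (0, 1) := by
    intro w
    have : w = w.1 • (1, 0) + w.2 • (0, 1) := by ext <;> simp
    conv_lhs => rw [this]
    rw [map_add, map_zsmul, map_zsmul, zsmul_eq_mul, zsmul_eq_mul]
  have hp0 : pole n e m d 0 = 0 := by simp [pole]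
  have hp1 : pole n e m d 1 = 0 := by simp [pole, Nat.div_eq_of_lt (show 1 < d by lia)]
  have hpd : pole n e m d d = n := by
    have := pole_add (n := n) (e := e) (m := m) (d := d) (a := 0) (b := 1) (l := 0)
      (by lia) (by lia)
    simpa using this
  have hpmd : pole n e m d (d * m) = n * m + e := by
    have := pole_add (n := n) (e := e) (m := m) (d := d) (a := 0) (b := 0) (l := 1)
      (by lia) (by lia)
    simpa using this
  have hwx : IsLeadExponent n e m d (0, 1) := by simp [IsLeadExponent, hp0]
  have hws : IsLeadExponent n e m d (1, 0) := by simp [IsLeadExponent]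
  have hwy : IsLeadExponent n e m d (d, -n) := by simp [IsLeadExponent, hpd]
  have hwz : IsLeadExponent n e m d (d * m, -(n * m + e)) := by
    refine ⟨by positivity, ?_⟩
    simp only
    rw [← Nat.cast_mul, Int.toNat_natCast, hpmd]
    push_cast
    exact le_rfl
  -- The weights of `x`, `s` and `z` in units of `-l Δ`. That of `z` is `m * d * B - (n * m + e) *
  -- A`, whence `h2` below.
  obtain ⟨A, hA⟩ := hmul _ hwx
  obtain ⟨B, hB⟩ := hmul _ hws
  obtain ⟨Z, hZ⟩ := hmul _ hwz
  have hτ : l Δ ≠ 0 := by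
    intro h
    refine hl (AddMonoidHom.ext fun w => ?_)
    rw [hform, hA, hB, h]
    simp
  have hdiv : ∀ w : ℤ × ℤ, l w = ((-(w.1 * B + w.2 * A) : ℤ) : k) * l Δ := by
    intro w
    rw [hform, hA, hB]
    push_cast
    ring
  obtain ⟨v, u⟩ := Δ
  obtain ⟨v, rfl⟩ : ∃ v' : ℕ, v = v' := ⟨v.toNat, by simp only at hΔ; lia⟩
  -- Evaluating the normalized form at `Δ` itself.
  have h1 : (A : ℤ) * u + B * v = -1 := by
    have h := hdiv (v, u)
    rw [eq_comm, mul_eq_right₀ hτ] at h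
    have h' : -((v : ℤ) * B + u * A) = 1 := by exact_mod_cast h
    linarith
  have h2 : (n * m + e) * A ≤ m * d * B := by
    rw [hdiv, ← neg_mul] at hZ
    have h := mul_right_cancel₀ hτ hZ
    have h' : -(((d * m : ℤ)) * B + (-(n * m + e)) * A) = -(Z : ℤ) := by exact_mod_cast h
    zify
    linarith [Int.natCast_nonneg Z]
  refine no_positive_root hd hm hn hne h1 h2 (fun h => ?_) (fun h => ?_) (fun h => ?_)
  · have hlw : l (0, 1) ≠ 0 := by
      rw [hA]
      exact neg_ne_zero.2 (mul_ne_zero (by exact_mod_cast h) hτ)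
    simpa using (hshift _ hwx hlw).2
  · have hlw : l (1, 0) ≠ 0 := by
      rw [hB]
      exact neg_ne_zero.2 (mul_ne_zero (by exact_mod_cast h) hτ)
    have := (hshift _ hws hlw).2
    simp only [Prod.mk_add_mk, zero_add] at this
    rwa [show (1 + (v : ℤ)).toNat = v + 1 by lia] at this
  · have hlw : l (d, -n) ≠ 0 := by
      rw [hdiv]
      refine mul_ne_zero ?_ hτ
      rw [Int.cast_ne_zero]
      intro h0
      apply h
      zify
      simp only at h0
      linarith
    have := (hshift _ hwy hlw).2
    simp only [Prod.mk_add_mk] at this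
    rw [show ((d : ℤ) + (v : ℤ)).toNat = v + d by lia] at this
    linarith

end RRing

/-! ### Classification of the locally nilpotent derivations -/

namespace Laurent2

theorem LexLE.mem_degLE {f : Laurent2 k} {w : ℤ × ℤ} (hf : LexLE f w) : f ∈ degLE k w.1 := by
  intro g hg
  by_contra h
  have := hf g h
  rw [Prod.Lex.toLex_le_toLex] at this
  lia

theorem coeff_aeval_mono (g : Polynomial k) (t : ℕ) :
    (Polynomial.aeval (mono 0 1 : Laurent2 k) g).coeff (0, t) = g.coeff t := by
  induction g using Polynomial.induction_on' with
  | add p q hp hq => simp [hp, hq]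
  | monomial i r =>
    rw [Polynomial.aeval_monomial, ← Algebra.smul_def, mono_pow, AddMonoidAlgebra.coeff_smul,
      Finsupp.smul_apply, coeff_mono, Polynomial.coeff_monomial]
    simp

end Laurent2

namespace RRing

variable {n e m : ℕ} {P : Polynomial (Polynomial k)}

theorem mem_degFil_iff {N : ℤ} {a : RRing n e m P} :
    a ∈ degFil n e m P N ↔ toLaurent n e m P a ∈ degLE k N := Iff.rfl

theorem isDomain (hP : P.Monic) (hd : 2 ≤ P.natDegree) (hm : 2 ≤ m) : IsDomain (RRing n e m P) :=
  (toLaurent_injective hP hd hm).isDomain (toLaurent n e m P).toRingHom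

theorem x_ne_zero : x n e m P ≠ 0 := by
  intro h
  apply mono_ne_zero (k := k) 0 1
  rw [← toLaurent_x (n := n) (e := e) (m := m) (P := P), h, map_zero]

theorem derivation_ext (hP : P.Monic) (hd : 2 ≤ P.natDegree) (hm : 2 ≤ m)
    {D₁ D₂ : Derivation k (RRing n e m P) (RRing n e m P)}
    (hx : D₁ (x n e m P) = D₂ (x n e m P)) (hs : D₁ (s n e m P) = D₂ (s n e m P)) : D₁ = D₂ := by
  have := isDomain (n := n) (e := e) hP hd hm
  have h := derivation_eq_zero (AlgHom.id k (RRing n e m P)) x_ne_zero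
    ((D₁ - D₂ : Derivation k (RRing n e m P) (RRing n e m P)) : RRing n e m P →ₗ[k] RRing n e m P)
    (fun a b => (D₁ - D₂).leibniz a b) (by simp [hx]) (by simp [hs])
  ext a
  have := LinearMap.congr_fun h a
  simpa [sub_eq_zero] using this

/-- The chain rule for derivations of `R_{n,e,P}`. -/
theorem toLaurent_derivation
    (D : Derivation k (RRing n e m P) (RRing n e m P)) (a : RRing n e m P) :
    toLaurent n e m P (D a) =
      mono 0 (-1) * toLaurent n e m P (D (x n e m P)) * eulerX k (toLaurent n e m P a) +
      mono (-1) 0 * toLaurent n e m P (D (s n e m P)) * eulerS k (toLaurent n e m P a) := by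
  set ι := toLaurent n e m P
  set p := mono 0 (-1) * ι (D (x n e m P)) with hp
  set q := mono (-1) 0 * ι (D (s n e m P)) with hq
  let δ : RRing n e m P →ₗ[k] Laurent2 k := ι.toLinearMap ∘ₗ (D : RRing n e m P →ₗ[k] _) -
    (((p • eulerX k + q • eulerS k : Derivation k (Laurent2 k) (Laurent2 k)) :
      Laurent2 k →ₗ[k] Laurent2 k) ∘ₗ ι.toLinearMap)
  have hδ : ∀ b, δ b = ι (D b) - (p * eulerX k (ι b) + q * eulerS k (ι b)) := fun b => rfl
  have h0 : δ = 0 := by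
    refine derivation_eq_zero ι ?_ δ (fun a b => ?_) ?_ ?_
    · rw [toLaurent_x]; exact mono_ne_zero _ _
    · simp only [hδ, map_mul, D.leibniz, (eulerX k).leibniz, (eulerS k).leibniz, map_add,
        smul_eq_mul]
      ring
    · rw [hδ, toLaurent_x, eulerX_mono, eulerS_mono, hp, mul_right_comm]
      simp [mono_mul, mono_zero]
    · rw [hδ, toLaurent_s, eulerX_mono, eulerS_mono, hq, mul_right_comm (mono (-1) 0)]
      simp [mono_mul, mono_zero]
  have := LinearMap.congr_fun h0 a
  rwa [hδ, LinearMap.zero_apply, sub_eq_zero] at this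

theorem isLeadExponent_of_lexLE (hP : P.Monic) (hd : 2 ≤ P.natDegree) (hm : 2 ≤ m)
    {a : RRing n e m P} {w : ℤ × ℤ} (ha : LexLE (toLaurent n e m P a) w)
    (hw : (toLaurent n e m P a).coeff w ≠ 0) : IsLeadExponent n e m P.natDegree w := by
  have h1 : a ∈ degFil n e m P w.1 := ha.mem_degLE
  have h2 : 0 ≤ w.1 := by
    by_contra h
    rw [eq_zero_of_mem_degFil_neg hP hd hm (by lia) h1] at hw
    simp at hw
  refine ⟨h2, ?_⟩
  by_contra h
  rw [← Int.toNat_of_nonneg h2] at h1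
  have := coeff_toLaurent_eq_zero hP hd hm h1 (c := w.2) (by lia)
  rw [Int.toNat_of_nonneg h2] at this
  exact hw this

/-- The terms of `p` and `q` at `Δ` act on the leading term by the scalar `l`; all other
contributions are lexicographically smaller. When a factor `l` vanishes, `w + r • Δ` remains an
upper bound. -/
theorem lexLE_iterate {D : Derivation k (RRing n e m P) (RRing n e m P)} {p q : Laurent2 k}
    (hD : ∀ a, toLaurent n e m P (D a) =
      p * eulerX k (toLaurent n e m P a) + q * eulerS k (toLaurent n e m P a))
    {Δ : ℤ × ℤ} (hp : LexLE p Δ) (hq : LexLE q Δ) {l : ℤ × ℤ →+ k}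
    (hl : ∀ w : ℤ × ℤ, l w = p.coeff Δ * w.2 + q.coeff Δ * w.1) {a : RRing n e m P} {w : ℤ × ℤ}
    (ha : LexLE (toLaurent n e m P a) w) (r : ℕ) :
    LexLE (toLaurent n e m P (D^[r] a)) (w + r • Δ) ∧
    (toLaurent n e m P (D^[r] a)).coeff (w + r • Δ) =
      (∏ i ∈ Finset.range r, l (w + i • Δ)) * (toLaurent n e m P a).coeff w := by
  induction r with
  | zero => simpa using ha
  | succ r ih =>
    obtain ⟨h1, h2⟩ := ih
    have hw : w + (r + 1) • Δ = Δ + (w + r • Δ) := by rw [succ_nsmul]; abel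
    have hX : LexLE (eulerX k (toLaurent n e m P (D^[r] a))) (w + r • Δ) := h1.euler _
    have hS : LexLE (eulerS k (toLaurent n e m P (D^[r] a))) (w + r • Δ) := h1.euler _
    rw [Function.iterate_succ_apply', hD, hw]
    refine ⟨(hp.mul hX).add (hq.mul hS), ?_⟩
    rw [AddMonoidAlgebra.coeff_add, Finsupp.add_apply, hp.coeff_mul hX, hq.coeff_mul hS,
      coeff_eulerX, coeff_eulerS, h2, Finset.prod_range_succ, hl (w + r • Δ)]
    ring

theorem exists_hasLead (hP : P.Monic) (hd : 2 ≤ P.natDegree) (hm : 2 ≤ m) {w : ℤ × ℤ}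
    (hw : IsLeadExponent n e m P.natDegree w) :
    ∃ a : RRing n e m P, HasLead (toLaurent n e m P a) w.1 w.2 := by
  obtain ⟨h1, h2⟩ := hw
  have := hasLead_x_pow_mul_monomial (n := n) (e := e) hP hd hm
    (w.2 + pole n e m P.natDegree w.1.toNat).toNat w.1.toNat
  rw [Int.toNat_of_nonneg h1, Int.toNat_of_nonneg (by lia), add_sub_cancel_right] at this
  exact ⟨_, this⟩

/-- Once the shift has negative degree, `p` and `q` have degree at most `-1`. Then `D x = x * p` has
negative degree, so it vanishes, and `D s = s * q` has degree at most `0`. -/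
theorem lnd_map [CharZero k] (hP : P.Monic) (hd : 2 ≤ P.natDegree) (hm : 2 ≤ m) (hn : 1 ≤ n)
    (hne : (n, e) ≠ (1, 0)) {D : Derivation k (RRing n e m P) (RRing n e m P)} (hD : IsLND D) :
    D (x n e m P) = 0 ∧ D (s n e m P) ∈ degFil n e m P 0 := by
  have hchain := toLaurent_derivation D
  set p := mono 0 (-1) * toLaurent n e m P (D (x n e m P)) with hp
  set q := mono (-1) 0 * toLaurent n e m P (D (s n e m P)) with hq
  have hp' : toLaurent n e m P (D (x n e m P)) = mono 0 1 * p := by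
    rw [hp, ← mul_assoc, mono_mul]
    simp [mono_zero]
  have hq' : toLaurent n e m P (D (s n e m P)) = mono 1 0 * q := by
    rw [hq, ← mul_assoc, mono_mul]
    simp [mono_zero]
  suffices h : p ∈ degLE k (-1) ∧ q ∈ degLE k (-1) by
    constructor
    · refine eq_zero_of_mem_degFil_neg hP hd hm (by lia : (-1 : ℤ) < 0) ?_
      rw [mem_degFil_iff, hp']
      simpa using mul_mem_degLE (mono_mem_degLE (k := k) (b := 1) (le_refl 0)) h.1
    · rw [mem_degFil_iff, hq']
      simpa using mul_mem_degLE (mono_mem_degLE (k := k) (b := 0) (le_refl 1)) h.2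
  by_cases hpq : p = 0 ∧ q = 0
  · rw [hpq.1, hpq.2]
    exact ⟨zero_mem _, zero_mem _⟩
  rw [not_and_or] at hpq
  obtain ⟨Δ, hpΔ, hqΔ, hΔ⟩ := exists_lexLE hpq
  let l : ℤ × ℤ →+ k :=
    (AddMonoidHom.mulLeft (p.coeff Δ)).comp ((Int.castAddHom k).comp (AddMonoidHom.snd ℤ ℤ)) +
    (AddMonoidHom.mulLeft (q.coeff Δ)).comp ((Int.castAddHom k).comp (AddMonoidHom.fst ℤ ℤ))
  have hl : ∀ w : ℤ × ℤ, l w = p.coeff Δ * w.2 + q.coeff Δ * w.1 := fun w => rfl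
  have hl0 : l ≠ 0 := by
    intro h
    have h1 := hl (0, 1)
    have h2 := hl (1, 0)
    rw [h] at h1 h2
    simp at h1 h2
    rcases hΔ with h | h
    exacts [h h1.symm, h h2.symm]
  have hlead : ∀ w, IsLeadExponent n e m P.natDegree w → ∃ a : RRing n e m P,
      LexLE (toLaurent n e m P a) w ∧ (toLaurent n e m P a).coeff w = 1 := by
    intro w hw
    obtain ⟨a, ha⟩ := exists_hasLead hP hd hm hw
    exact ⟨a, ha.lexLE, by simpa using ha.coeff w.2⟩
  have hneg : Δ.1 < 0 := by
    refine shift_fst_neg hd hm hn hne hl0 (fun w hw => ?_) (fun w hw hlw => ?_)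
    · obtain ⟨a, ha, ha1⟩ := hlead w hw
      obtain ⟨r, hr⟩ := hD a
      have := (lexLE_iterate hchain hpΔ hqΔ hl ha r).2
      rw [hr, ha1, mul_one] at this
      exact ⟨r, by simpa using this.symm⟩
    · obtain ⟨a, ha, ha1⟩ := hlead w hw
      obtain ⟨h1, h2⟩ := lexLE_iterate hchain hpΔ hqΔ hl ha 1
      rw [one_nsmul] at h1 h2
      refine isLeadExponent_of_lexLE hP hd hm h1 ?_
      rw [h2, ha1]
      simpa using hlw
  exact ⟨degLE_mono (by lia) hpΔ.mem_degLE, degLE_mono (by lia) hqΔ.mem_degLE⟩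

theorem mem_degFil_zero_iff (hP : P.Monic) (hd : 2 ≤ P.natDegree) (hm : 2 ≤ m)
    {a : RRing n e m P} :
    a ∈ degFil n e m P 0 ↔ ∃ f : Polynomial k, a = Polynomial.aeval (x n e m P) f := by
  constructor
  · intro h
    rw [degFil_eq_span hP hd hm] at h
    induction h using Submodule.span_induction with
    | mem a h =>
      obtain ⟨⟨i, j⟩, hp, rfl⟩ := h
      obtain rfl : j = 0 := by
        simp at hp
        exact hp
      exact ⟨Polynomial.X ^ i, by simp [monomial]⟩
    | zero => exact ⟨0, by simp⟩
    | add a b _ _ ha hb =>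
      obtain ⟨f, rfl⟩ := ha
      obtain ⟨g, rfl⟩ := hb
      exact ⟨f + g, by simp⟩
    | smul r a _ ha =>
      obtain ⟨f, rfl⟩ := ha
      exact ⟨r • f, by simp⟩
  · rintro ⟨f, rfl⟩
    rw [mem_degFil_iff, ← Polynomial.aeval_algHom_apply, toLaurent_x]
    exact aeval_mono_mem_degLE f

theorem toLaurent_aeval_x (f : Polynomial k) :
    toLaurent n e m P (Polynomial.aeval (x n e m P) f) = Polynomial.aeval (mono 0 1) f := by
  rw [← Polynomial.aeval_algHom_apply, toLaurent_x]

theorem aeval_x_injective :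
    Function.Injective (Polynomial.aeval (x n e m P) : Polynomial k →ₐ[k] _) := by
  intro f g h
  ext t
  rw [← coeff_aeval_mono, ← coeff_aeval_mono, ← toLaurent_aeval_x (n := n) (e := e) (m := m) (P := P),
    h, toLaurent_aeval_x]

theorem pole_mul_natDegree_sub_one (hd : 2 ≤ P.natDegree) (hm : 2 ≤ m) :
    pole n e m P.natDegree (m * P.natDegree - 1) = n * (m - 1) := by
  have := pole_add (n := n) (e := e) (m := m) (d := P.natDegree) (a := P.natDegree - 1)
    (b := m - 1) (l := 0) (by lia) (by lia)
  rw [mul_zero, add_zero, mul_zero, add_zero] at this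
  rw [← this]
  congr 1
  obtain ⟨m, rfl⟩ : ∃ m', m = m' + 1 := ⟨m - 1, by lia⟩
  rw [Nat.add_sub_cancel, add_mul, mul_comm m]
  lia

/-- `D z = f(x) * dz/ds` has leading coefficient `m * d * f * x ^ (-(n * m + e))` in degree `m * d -
1`, where poles have order at most `n * (m - 1)`. The difference of the two orders is `n + e`. -/
theorem lnd_map_s_dvd [CharZero k] (hP : P.Monic) (hd : 2 ≤ P.natDegree) (hm : 2 ≤ m)
    {D : Derivation k (RRing n e m P) (RRing n e m P)} (hx : D (x n e m P) = 0)
    {f : Polynomial k} (hs : D (s n e m P) = Polynomial.aeval (x n e m P) f) :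
    Polynomial.X ^ (n + e) ∣ f := by
  set d := P.natDegree with hdd
  have hmd : 0 < m * d := by positivity
  have hchain := toLaurent_derivation D (z n e m P)
  rw [hx, hs, map_zero, mul_zero, zero_mul, zero_add, toLaurent_z, toLaurent_aeval_x] at hchain
  have hz : eulerS k (zLaurent n e m P) - ((m * d : ℕ) : k) • mono (m * d) (-(n * m + e)) ∈
      degLE k (m * d - 1) := by
    have h := hasLead_zLaurent n e hP hd hm
    intro g hg
    have h1 := h g (by simpa using hg)
    rw [AddMonoidAlgebra.coeff_sub, Finsupp.sub_apply] at h1 ⊢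
    rw [AddMonoidAlgebra.coeff_smul, Finsupp.smul_apply, coeff_eulerS, sub_eq_zero.1 h1, coeff_mono,
      smul_eq_mul]
    split_ifs with h2
    · rw [← h2]; simp [hdd]
    · simp
  have hf := aeval_mono_mem_degLE (k := k) f
  have hDz : D (z n e m P) ∈ degFil n e m P ((m * d - 1 : ℕ) : ℤ) := by
    rw [mem_degFil_iff, hchain]
    have h1 : eulerS k (zLaurent n e m P) ∈ degLE k (m * d) := fun g hg => by
      rw [coeff_eulerS, (hasLead_zLaurent n e hP hd hm).mem_degLE g hg, mul_zero]
    refine degLE_mono ?_ (mul_mem_degLE (mul_mem_degLE (mono_mem_degLE le_rfl) hf) h1)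
    push_cast [hmd]
    lia
  refine Polynomial.X_pow_dvd_iff.2 fun t ht => ?_
  -- For `t < n + e` this exponent of `x` lies below the bound `-n * (m - 1)`.
  have h0 := coeff_toLaurent_eq_zero hP hd hm hDz (c := t - (n * m + e)) (by
    rw [← hdd, pole_mul_natDegree_sub_one hd hm]
    obtain ⟨m, rfl⟩ : ∃ m', m = m' + 1 := ⟨m - 1, by lia⟩
    rw [Nat.add_sub_cancel]
    push_cast
    ring_nf
    lia)
  have hlow := mul_mem_degLE hf hz
  have h2 := hlow (m * d, t - (n * m + e)) (by simp)
  rw [hchain, mul_assoc, coeff_mono_mul] at h0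
  rw [mul_sub, AddMonoidAlgebra.coeff_sub, Finsupp.sub_apply, sub_eq_zero, mul_smul_comm,
    AddMonoidAlgebra.coeff_smul, Finsupp.smul_apply, mul_comm _ (mono _ _), coeff_mono_mul] at h2
  push_cast [hmd] at h0
  simp only [sub_neg_eq_add, sub_add_cancel, sub_zero, sub_self, smul_eq_mul] at h0 h2
  rw [h0, coeff_aeval_mono] at h2
  refine (mul_eq_zero.1 h2.symm).resolve_left ?_
  exact_mod_cast hmd.ne'

theorem lnd_eq_smul [CharZero k] (hP : P.Monic) (hd : 2 ≤ P.natDegree) (hm : 2 ≤ m) (hn : 1 ≤ n)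
    (hne : (n, e) ≠ (1, 0)) {E D : Derivation k (RRing n e m P) (RRing n e m P)}
    (hE : IsBasicDerivation E) (hD : IsLND D) :
    ∃ h : Polynomial k, D = Polynomial.aeval (x n e m P) h • E := by
  obtain ⟨hx, hs⟩ := lnd_map hP hd hm hn hne hD
  obtain ⟨f, hf⟩ := (mem_degFil_zero_iff hP hd hm).1 hs
  obtain ⟨h, rfl⟩ := lnd_map_s_dvd hP hd hm hx hf
  refine ⟨h, derivation_ext hP hd hm ?_ ?_⟩
  · rw [hx, Derivation.smul_apply, hE.map_x hP hd hm, smul_zero]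
  · rw [hf, Derivation.smul_apply, hE.map_s hP hd hm, map_mul, map_pow, Polynomial.aeval_X,
      smul_eq_mul, mul_comm]

theorem smul_iterate (hP : P.Monic) (hd : 2 ≤ P.natDegree) (hm : 2 ≤ m)
    {E : Derivation k (RRing n e m P) (RRing n e m P)} (hE : IsBasicDerivation E)
    (h : Polynomial k) (r : ℕ) (a : RRing n e m P) :
    (Polynomial.aeval (x n e m P) h • E)^[r] a = Polynomial.aeval (x n e m P) h ^ r * E^[r] a := by
  have h1 : E (Polynomial.aeval (x n e m P) h) = 0 :=
    by
    have h2 := hE.map_mem_degFil ((mem_degFil_zero_iff hP hd hm).2 ⟨h, rfl⟩)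
    exact eq_zero_of_mem_degFil_neg hP hd hm (by lia) h2
  induction r with
  | zero => simp
  | succ r ih =>
    rw [Function.iterate_succ_apply', ih, Derivation.smul_apply, E.leibniz, E.leibniz_pow, h1,
      Function.iterate_succ_apply']
    simp only [smul_eq_mul]
    ring

/-- Here `D = h(x) * E`, where `h(x)` is a nonzero element killed by `E` in a domain, so the
iterates of `D` and `E` have the same kernels, whatever `D` is. -/
theorem iterate_lnd_eq_zero_iff [CharZero k] (hP : P.Monic) (hd : 2 ≤ P.natDegree) (hm : 2 ≤ m)
    (hn : 1 ≤ n) (hne : (n, e) ≠ (1, 0)) {D : Derivation k (RRing n e m P) (RRing n e m P)}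
    (hD : IsLND D) (hD0 : D ≠ 0) (r : ℕ) (a : RRing n e m P) :
    D^[r] a = 0 ↔ a ∈ degFil n e m P (r - 1) := by
  have := isDomain (n := n) (e := e) hP hd hm
  obtain ⟨E, hE⟩ := exists_derivation n e m P hP hd hm
  have hE : IsBasicDerivation E := hE
  obtain ⟨h, rfl⟩ := lnd_eq_smul hP hd hm hn hne hE hD
  have h0 : Polynomial.aeval (x n e m P) h ≠ 0 := by
    intro h0
    refine hD0 (Derivation.ext fun b => ?_)
    rw [Derivation.smul_apply, h0, smul_eq_mul, zero_mul]
    rfl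
  rw [smul_iterate hP hd hm hE, mul_eq_zero, or_iff_right (pow_ne_zero _ h0),
    hE.iterate_eq_zero_iff hP hd hm]

theorem IsBasicDerivation.isLND [CharZero k] (hP : P.Monic) (hd : 2 ≤ P.natDegree) (hm : 2 ≤ m)
    {E : Derivation k (RRing n e m P) (RRing n e m P)} (hE : IsBasicDerivation E) :
    IsLND E := by
  intro a
  obtain ⟨N, hN⟩ := exists_mem_degFil a
  exact ⟨N + 1, (hE.iterate_eq_zero_iff hP hd hm _ _).2 (by simpa using hN)⟩

theorem IsBasicDerivation.ne_zero (hP : P.Monic) (hd : 2 ≤ P.natDegree) (hm : 2 ≤ m)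
    {E : Derivation k (RRing n e m P) (RRing n e m P)} (hE : IsBasicDerivation E) : E ≠ 0 := by
  have := isDomain (n := n) (e := e) hP hd hm
  rintro rfl
  have := hE.map_s hP hd hm
  exact pow_ne_zero _ x_ne_zero this.symm

end RRing

/-! ### The subrings of the chain -/

namespace BRing

variable {n : ℕ} {P : Polynomial (Polynomial k)}

theorem adjoin_eq_top : Algebra.adjoin k {x n P, s n P, y n P} = ⊤ := by
  rw [eq_top_iff]
  rintro a -
  obtain ⟨p, rfl⟩ := Ideal.Quotient.mkₐ_surjective k _ a
  induction p using MvPolynomial.induction_on with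
  | C r =>
    rw [← MvPolynomial.algebraMap_eq, AlgHom.commutes]
    exact Subalgebra.algebraMap_mem _ r
  | add p q hp hq => rw [map_add]; exact add_mem hp hq
  | mul_X p i hp =>
    rw [map_mul]
    refine mul_mem hp (Algebra.subset_adjoin ?_)
    fin_cases i
    · exact Or.inl rfl
    · exact Or.inr (Or.inl rfl)
    · exact Or.inr (Or.inr rfl)

theorem algHom_ext' {A : Type*} [CommRing A] [Algebra k A] {f g : BRing n P →ₐ[k] A}
    (hx : f (x n P) = g (x n P)) (hs : f (s n P) = g (s n P)) (hy : f (y n P) = g (y n P)) :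
    f = g := by
  refine AlgHom.ext_of_adjoin_eq_top adjoin_eq_top ?_
  rintro a (rfl | rfl | rfl)
  exacts [hx, hs, hy]

variable {A : Type*} [CommRing A] [Algebra k A] (a b c : A) (h : a ^ n * c = evalXS P a b)

theorem lift_x : lift a b c h (x n P) = a := by
  change MvPolynomial.aeval ![a, b, c] (MvPolynomial.X 0) = a
  simp

theorem lift_s : lift a b c h (s n P) = b := by
  change MvPolynomial.aeval ![a, b, c] (MvPolynomial.X 1) = b
  simp

theorem lift_y : lift a b c h (y n P) = c := by
  change MvPolynomial.aeval ![a, b, c] (MvPolynomial.X 2) = c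
  simp

end BRing

theorem AlgHom.range_eq_adjoin_image {A C : Type*} [CommRing A] [Algebra k A] [CommRing C]
    [Algebra k C] (f : C →ₐ[k] A) {G : Set C} (hG : Algebra.adjoin k G = ⊤) :
    f.range = Algebra.adjoin k (f '' G) := by
  rw [← Algebra.map_top, ← hG, AlgHom.map_adjoin]

section Embeddings

variable {n₀ n e₀ e m : ℕ} {P : Polynomial (Polynomial k)}

theorem bEmb_x (h : n₀ ≤ n) : bEmb h e m P (BRing.x n₀ P) = RRing.x n e m P := by
  simp [bEmb, bToB, bToR, BRing.lift_x]

theorem bEmb_s (h : n₀ ≤ n) : bEmb h e m P (BRing.s n₀ P) = RRing.s n e m P := by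
  simp [bEmb, bToB, bToR, BRing.lift_s]

theorem bEmb_y (h : n₀ ≤ n) : bEmb h e m P (BRing.y n₀ P) =
    RRing.x n e m P ^ (n - n₀) * RRing.y n e m P := by
  simp [bEmb, bToB, bToR, BRing.lift_x, BRing.lift_y]

theorem bToR_eq_bEmb : bToR n e m P = bEmb le_rfl e m P := by
  refine BRing.algHom_ext' ?_ ?_ ?_
  · rw [bEmb_x, bToR, BRing.lift_x]
  · rw [bEmb_s, bToR, BRing.lift_s]
  · rw [bEmb_y, bToR, BRing.lift_y, Nat.sub_self, pow_zero, one_mul]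

theorem rEmb_x (h : e₀ ≤ e) : rEmb n h m P (RRing.x n e₀ m P) = RRing.x n e m P :=
  RRing.lift_x _ _ _ _

theorem rEmb_y (h : e₀ ≤ e) : rEmb n h m P (RRing.y n e₀ m P) = RRing.y n e m P :=
  RRing.lift_y _ _ _ _

theorem rEmb_z (h : e₀ ≤ e) : rEmb n h m P (RRing.z n e₀ m P) =
    RRing.x n e m P ^ (e - e₀) * RRing.z n e m P :=
  RRing.lift_z _ _ _ _

theorem rEmb_s (h : e₀ ≤ e) : rEmb n h m P (RRing.s n e₀ m P) = RRing.s n e m P := by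
  rw [rEmb, RRing.lift_s, ← mul_assoc, ← pow_add, Nat.add_sub_cancel' h, RRing.s]

theorem bEmb_range (h : n₀ ≤ n) : (bEmb h e m P).range = Algebra.adjoin k
    {RRing.x n e m P, RRing.s n e m P, RRing.x n e m P ^ (n - n₀) * RRing.y n e m P} := by
  rw [AlgHom.range_eq_adjoin_image _ BRing.adjoin_eq_top, Set.image_insert_eq, Set.image_insert_eq,
    Set.image_singleton, bEmb_x, bEmb_s, bEmb_y]

theorem bToR_range : (bToR n e m P).range = Algebra.adjoin k
    {RRing.x n e m P, RRing.s n e m P, RRing.y n e m P} := by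
  rw [bToR_eq_bEmb, bEmb_range, Nat.sub_self, pow_zero, one_mul]

theorem rEmb_range (h : e₀ ≤ e) : (rEmb n h m P).range = Algebra.adjoin k
    {RRing.x n e m P, RRing.y n e m P, RRing.x n e m P ^ (e - e₀) * RRing.z n e m P} := by
  rw [AlgHom.range_eq_adjoin_image _ RRing.adjoin_eq_top, Set.image_insert_eq, Set.image_insert_eq,
    Set.image_singleton, rEmb_x, rEmb_y, rEmb_z]

variable (n m P) in
/-- The identification of `B_{n,P}` with `R_{n,0,P}`. -/
def bEquivR : BRing n P ≃ₐ[k] RRing n 0 m P :=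
  AlgEquiv.ofAlgHom (bToR n 0 m P)
    (RRing.lift (BRing.x n P) (BRing.y n P) (BRing.y n P ^ m - BRing.s n P)
      (by rw [pow_zero, one_mul, sub_sub_cancel, BRing.relation]))
    (by
      refine RRing.algHom_ext' ?_ ?_ ?_ <;>
      simp [RRing.lift_x, RRing.lift_y, RRing.lift_z, bToR, BRing.lift_x, BRing.lift_y,
        BRing.lift_s, RRing.s])
    (by
      refine BRing.algHom_ext' ?_ ?_ ?_ <;>
      simp [RRing.lift_x, RRing.lift_y, RRing.lift_s, bToR, BRing.lift_x, BRing.lift_y,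
        BRing.lift_s])

theorem bToR_bijective : Function.Bijective (bToR n 0 m P) := (bEquivR n m P).bijective

/-- All rings of the chain sit compatibly in one Laurent ring. Injectivity follows, and the pole
bounds of a smaller ring can be applied inside the larger one. -/
theorem toLaurent_bEmb (h : n₀ ≤ n) (c : BRing n₀ P) :
    RRing.toLaurent n e m P (bEmb h e m P c) =
      RRing.toLaurent n₀ 0 m P (bToR n₀ 0 m P c) := by
  have : (RRing.toLaurent n e m P).comp (bEmb h e m P) =
      (RRing.toLaurent n₀ 0 m P).comp (bToR n₀ 0 m P) := by
    refine BRing.algHom_ext' ?_ ?_ ?_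
    · simp only [AlgHom.comp_apply, bEmb_x, bToR_eq_bEmb, RRing.toLaurent_x]
    · simp only [AlgHom.comp_apply, bEmb_s, bToR_eq_bEmb, RRing.toLaurent_s]
    · simp only [AlgHom.comp_apply, bEmb_y, bToR_eq_bEmb, RRing.toLaurent_x, RRing.toLaurent_y,
        map_mul, map_pow, Nat.sub_self, pow_zero, one_mul]
      rw [RRing.yLaurent, RRing.yLaurent, ← mul_assoc, mono_pow, mono_mul]
      congr 2
      simp only [mul_one]
      push_cast [h]
      ring
  exact AlgHom.congr_fun this c

theorem toLaurent_rEmb (h : e₀ ≤ e) (c : RRing n e₀ m P) :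
    RRing.toLaurent n e m P (rEmb n h m P c) = RRing.toLaurent n e₀ m P c := by
  have : (RRing.toLaurent n e m P).comp (rEmb n h m P) = RRing.toLaurent n e₀ m P := by
    refine RRing.algHom_ext' ?_ ?_ ?_
    · simp only [AlgHom.comp_apply, rEmb_x, RRing.toLaurent_x]
    · simp only [AlgHom.comp_apply, rEmb_y, RRing.toLaurent_y]
    · simp only [AlgHom.comp_apply, rEmb_z, RRing.toLaurent_x, RRing.toLaurent_z, map_mul, map_pow]
      rw [RRing.zLaurent, RRing.zLaurent, ← mul_assoc, mono_pow, mono_mul]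
      congr 2
      simp only [mul_one]
      push_cast [h]
      ring
  exact AlgHom.congr_fun this c

theorem bEmb_injective (hP : P.Monic) (hd : 2 ≤ P.natDegree) (hm : 2 ≤ m) (h : n₀ ≤ n) :
    Function.Injective (bEmb h e m P) := by
  intro a b hab
  have := congrArg (RRing.toLaurent n e m P) hab
  rw [toLaurent_bEmb, toLaurent_bEmb] at this
  exact bToR_bijective.1 (RRing.toLaurent_injective hP hd hm this)

theorem rEmb_injective (hP : P.Monic) (hd : 2 ≤ P.natDegree) (hm : 2 ≤ m) (h : e₀ ≤ e) :
    Function.Injective (rEmb n h m P) := by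
  intro a b hab
  have := congrArg (RRing.toLaurent n e m P) hab
  rw [toLaurent_rEmb, toLaurent_rEmb] at this
  exact RRing.toLaurent_injective hP hd hm this

theorem bEmb_range_le {n₁ : ℕ} (h₀ : n₀ ≤ n₁) (h₁ : n₁ ≤ n) :
    (bEmb (h₀.trans h₁) e m P).range ≤ (bEmb h₁ e m P).range := by
  rw [bEmb_range, bEmb_range, Algebra.adjoin_le_iff]
  have hx : RRing.x n e m P ∈ Algebra.adjoin k
    {RRing.x n e m P, RRing.s n e m P, RRing.x n e m P ^ (n - n₁) * RRing.y n e m P} :=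
    Algebra.subset_adjoin (by simp)
  rintro a (rfl | rfl | rfl)
  · exact hx
  · exact Algebra.subset_adjoin (by simp)
  · rw [show n - n₀ = (n₁ - n₀) + (n - n₁) by lia, pow_add, mul_assoc]
    exact mul_mem (pow_mem hx _) (Algebra.subset_adjoin (by simp))

theorem rEmb_range_le {e₁ : ℕ} (h₀ : e₀ ≤ e₁) (h₁ : e₁ ≤ e) :
    (rEmb n (h₀.trans h₁) m P).range ≤ (rEmb n h₁ m P).range := by
  rw [rEmb_range, rEmb_range, Algebra.adjoin_le_iff]
  have hx : RRing.x n e m P ∈ Algebra.adjoin k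
    {RRing.x n e m P, RRing.y n e m P, RRing.x n e m P ^ (e - e₁) * RRing.z n e m P} :=
    Algebra.subset_adjoin (by simp)
  rintro a (rfl | rfl | rfl)
  · exact hx
  · exact Algebra.subset_adjoin (by simp)
  · rw [show e - e₀ = (e₁ - e₀) + (e - e₁) by lia, pow_add, mul_assoc]
    exact mul_mem (pow_mem hx _) (Algebra.subset_adjoin (by simp))

theorem bEmb_range_le_rEmb_range (h : e₀ ≤ e) :
    (bEmb (le_refl n) e m P).range ≤ (rEmb n h m P).range := by
  rw [bEmb_range, Algebra.adjoin_le_iff, Nat.sub_self, pow_zero, one_mul]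
  rintro a (rfl | rfl | rfl)
  · exact ⟨_, rEmb_x h⟩
  · exact ⟨_, rEmb_s h⟩
  · exact ⟨_, rEmb_y h⟩

end Embeddings

/-! ### The subalgebras generated by the degree filtration -/

namespace RRing

variable {n e m : ℕ} {P : Polynomial (Polynomial k)}

theorem x_mem_degFil : x n e m P ∈ degFil n e m P 0 := by
  rw [mem_degFil_iff, toLaurent_x]
  exact mono_mem_degLE le_rfl

theorem s_mem_degFil : s n e m P ∈ degFil n e m P 1 := by
  rw [mem_degFil_iff, toLaurent_s]
  exact mono_mem_degLE le_rfl

theorem y_mem_degFil (hP : P.Monic) : y n e m P ∈ degFil n e m P P.natDegree := by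
  rw [mem_degFil_iff, toLaurent_y]
  exact (hasLead_yLaurent n hP).mem_degLE

theorem z_mem_degFil (hP : P.Monic) (hd : 2 ≤ P.natDegree) (hm : 2 ≤ m) :
    z n e m P ∈ degFil n e m P (m * P.natDegree) := by
  rw [mem_degFil_iff, toLaurent_z]
  exact (hasLead_zLaurent n e hP hd hm).mem_degLE

theorem degFil_le_of_monomial_mem (hP : P.Monic) (hd : 2 ≤ P.natDegree) (hm : 2 ≤ m) {N : ℕ}
    {S : Subalgebra k (RRing n e m P)} (hx : x n e m P ∈ S)
    (h : ∀ j ≤ N, monomial n e m P j ∈ S) : degFil n e m P N ≤ Subalgebra.toSubmodule S := by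
  rw [degFil_eq_span hP hd hm, Submodule.span_le]
  rintro _ ⟨⟨i, j⟩, hj, rfl⟩
  exact S.mul_mem (S.pow_mem hx i) (h j (Int.ofNat_le.1 hj))

/-- Only one product has degree `N`, so each graded piece of the filtration is generated over `k[x]`
by one element. -/
theorem mem_degFil_succ (hP : P.Monic) (hd : 2 ≤ P.natDegree) (hm : 2 ≤ m) {N : ℕ}
    {a : RRing n e m P} (ha : a ∈ degFil n e m P N) : ∃ (q : Polynomial k) (r : RRing n e m P),
      r ∈ degFil n e m P (N - 1) ∧ a = Polynomial.aeval (x n e m P) q * monomial n e m P N + r := by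
  rw [degFil_eq_span hP hd hm] at ha
  induction ha using Submodule.span_induction with
  | mem a h =>
    obtain ⟨⟨i, j⟩, hj, rfl⟩ := h
    rcases (Int.ofNat_le.1 hj).lt_or_eq with h | h
    · refine ⟨0, _, ?_, by rw [map_zero, zero_mul, zero_add]⟩
      simp only at h
      exact degFil_mono (by lia) (hasLead_x_pow_mul_monomial hP hd hm i j).mem_degLE
    · simp only at h
      exact ⟨Polynomial.X ^ i, 0, zero_mem _, by simp [h]⟩
  | zero => exact ⟨0, 0, zero_mem _, by simp⟩
  | add a b _ _ ha hb =>
    obtain ⟨q, r, hr, rfl⟩ := ha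
    obtain ⟨q', r', hr', rfl⟩ := hb
    exact ⟨q + q', r + r', add_mem hr hr', by rw [map_add]; ring⟩
  | smul c a _ ha =>
    obtain ⟨q, r, hr, rfl⟩ := ha
    exact ⟨c • q, c • r, Submodule.smul_mem _ _ hr, by rw [map_smul, smul_add, smul_mul_assoc]⟩

theorem monomial_natDegree (hd : 2 ≤ P.natDegree) (hm : 2 ≤ m) :
    monomial n e m P P.natDegree = y n e m P := by
  have := exists_monomial_eq (n := n) (e := e) (m := m) (P := P) (a := 0) (b := 1)
    (by lia) (by lia) (by lia) (by lia) 0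
  simpa using this

theorem monomial_mul_natDegree_eq_z (hd : 2 ≤ P.natDegree) (hm : 2 ≤ m) :
    monomial n e m P (m * P.natDegree) = z n e m P := by
  have := exists_monomial_eq (n := n) (e := e) (m := m) (P := P) (a := 0) (b := 0)
    (by lia) (by lia) (by lia) (by lia) 1
  rw [mul_comm m]
  simpa using this

theorem degFil_le_adjoin_xs (hP : P.Monic) (hd : 2 ≤ P.natDegree) (hm : 2 ≤ m) {N : ℕ}
    (hN : N < P.natDegree) : degFil n e m P N ≤
      Subalgebra.toSubmodule (Algebra.adjoin k {x n e m P, s n e m P}) := by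
  refine degFil_le_of_monomial_mem hP hd hm (Algebra.subset_adjoin (by simp)) fun j hj => ?_
  rw [monomial, Nat.div_eq_of_lt (hj.trans_lt hN)]
  simp only [Nat.zero_mod, Nat.zero_div, pow_zero, mul_one]
  exact pow_mem (Algebra.subset_adjoin (by simp)) _

theorem degFil_le_adjoin_xsy (hP : P.Monic) (hd : 2 ≤ P.natDegree) (hm : 2 ≤ m) {N : ℕ}
    (hN : N < m * P.natDegree) : degFil n e m P N ≤
      Subalgebra.toSubmodule (Algebra.adjoin k {x n e m P, s n e m P, y n e m P}) := by
  refine degFil_le_of_monomial_mem hP hd hm (Algebra.subset_adjoin (by simp)) fun j hj => ?_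
  rw [monomial, Nat.div_div_eq_div_mul, Nat.div_eq_of_lt (b := P.natDegree * m) (by lia)]
  simp only [pow_zero, mul_one]
  exact mul_mem (pow_mem (Algebra.subset_adjoin (by simp)) _)
    (pow_mem (Algebra.subset_adjoin (by simp)) _)

variable (n e m P) in
/-- The subalgebra generated by the elements of degree at most `N` in `s`. -/
def degAdjoin (N : ℕ) : Subalgebra k (RRing n e m P) :=
  Algebra.adjoin k (degFil n e m P N : Set (RRing n e m P))

theorem degAdjoin_zero (hP : P.Monic) (hd : 2 ≤ P.natDegree) (hm : 2 ≤ m) :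
    degAdjoin n e m P 0 = Algebra.adjoin k {x n e m P} := by
  refine le_antisymm (Algebra.adjoin_le fun a ha => ?_) (Algebra.adjoin_mono ?_)
  · obtain ⟨f, rfl⟩ := (mem_degFil_zero_iff hP hd hm).1 ha
    exact Polynomial.aeval_mem_adjoin_singleton k _
  · rintro a rfl
    exact x_mem_degFil

theorem degAdjoin_of_lt (hP : P.Monic) (hd : 2 ≤ P.natDegree) (hm : 2 ≤ m) {N : ℕ} (hN : 1 ≤ N)
    (hN' : N < P.natDegree) : degAdjoin n e m P N = Algebra.adjoin k {x n e m P, s n e m P} := by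
  refine le_antisymm (Algebra.adjoin_le (degFil_le_adjoin_xs hP hd hm hN'))
    (Algebra.adjoin_mono ?_)
  rintro a (rfl | rfl)
  · exact degFil_mono (by lia) x_mem_degFil
  · exact degFil_mono (by lia) s_mem_degFil

theorem degAdjoin_of_lt_mul (hP : P.Monic) (hd : 2 ≤ P.natDegree) (hm : 2 ≤ m) {N : ℕ}
    (hN : P.natDegree ≤ N) (hN' : N < m * P.natDegree) :
    degAdjoin n e m P N = (bToR n e m P).range := by
  rw [bToR_range]
  refine le_antisymm (Algebra.adjoin_le (degFil_le_adjoin_xsy hP hd hm hN'))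
    (Algebra.adjoin_mono ?_)
  rintro a (rfl | rfl | rfl)
  · exact degFil_mono (by lia) x_mem_degFil
  · exact degFil_mono (by lia) s_mem_degFil
  · exact degFil_mono (by lia) (y_mem_degFil hP)

theorem degAdjoin_mul (hP : P.Monic) (hd : 2 ≤ P.natDegree) (hm : 2 ≤ m) :
    degAdjoin n e m P (m * P.natDegree) = ⊤ := by
  rw [eq_top_iff, ← adjoin_eq_top]
  refine Algebra.adjoin_mono ?_
  have h : P.natDegree ≤ m * P.natDegree := Nat.le_mul_of_pos_left _ (by lia)
  rintro a (rfl | rfl | rfl)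
  · exact degFil_mono (by lia) x_mem_degFil
  · exact degFil_mono (by lia) (y_mem_degFil hP)
  · exact degFil_mono (by push_cast; rfl) (z_mem_degFil hP hd hm)

theorem s_notMem_degFil : s n e m P ∉ degFil n e m P 0 := by
  intro h
  have := h (1, 0) (by simp)
  rw [AlgHom.toLinearMap_apply, toLaurent_s, coeff_mono] at this
  simp at this

/-- `k[x, s]` lies in the image of `B_{0,P}`, where `n = e = 0` and leading coefficients have no
pole, whereas that of `y` is `x ^ (-n)`. -/
theorem y_notMem_adjoin (hP : P.Monic) (hd : 2 ≤ P.natDegree) (hm : 2 ≤ m) (hn : 1 ≤ n) :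
    y n e m P ∉ Algebra.adjoin k {x n e m P, s n e m P} := by
  intro h
  have hle : Algebra.adjoin k {x n e m P, s n e m P} ≤ (bEmb (Nat.zero_le n) e m P).range := by
    rw [bEmb_range]
    refine Algebra.adjoin_mono ?_
    rintro a (rfl | rfl) <;> simp
  obtain ⟨c, hc⟩ := hle h
  have h1 := toLaurent_bEmb (Nat.zero_le n) (e := e) (m := m) c
  rw [show bEmb (Nat.zero_le n) e m P c = y n e m P from hc, toLaurent_y] at h1
  have h2 := hasLead_yLaurent n hP
  rw [h1] at h2
  have h3 := coeff_toLaurent_eq_zero hP hd hm (mem_degFil_iff.2 h2.mem_degLE) (c := -n) (by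
    simp [pole]
    lia)
  rw [h2.coeff, if_pos rfl] at h3
  exact one_ne_zero h3

/-- In degree `m * d` the elements of `B_{n,P} ≅ R_{n,0,P}` have poles of order at most `n * m`,
while `z` has one of order `n * m + e`. -/
theorem z_notMem_range (hP : P.Monic) (hd : 2 ≤ P.natDegree) (hm : 2 ≤ m) (he : 1 ≤ e) :
    z n e m P ∉ (bToR n e m P).range := by
  rw [bToR_eq_bEmb]
  rintro ⟨c, hc⟩
  have h1 := toLaurent_bEmb (le_refl n) (e := e) (m := m) c
  rw [show bEmb (le_refl n) e m P c = z n e m P from hc, toLaurent_z] at h1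
  have h2 := hasLead_zLaurent n e hP hd hm
  rw [h1, ← Nat.cast_mul] at h2
  have h3 := coeff_toLaurent_eq_zero hP hd hm (mem_degFil_iff.2 h2.mem_degLE)
    (c := -(n * m + e)) (by
      have := pole_add (n := n) (e := 0) (m := m) (d := P.natDegree) (a := 0) (b := 0) (l := 1)
        (by lia) (by lia)
      simp only [zero_add, mul_one, mul_zero, add_zero] at this
      rw [mul_comm m, this]
      push_cast
      lia)
  rw [h2.coeff, if_pos rfl] at h3
  exact one_ne_zero h3

/-- The coefficients of a polynomial in `x` and `s` can be read off from its Laurent image. -/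
theorem algebraicIndependent_x_s : AlgebraicIndependent k ![x n e m P, s n e m P] := by
  rw [algebraicIndependent_iff_injective_aeval]
  have key : ∀ (p : MvPolynomial (Fin 2) k) (t : Fin 2 →₀ ℕ),
      (toLaurent n e m P (MvPolynomial.aeval ![x n e m P, s n e m P] p)).coeff (t 1, t 0) =
        p.coeff t := by
    intro p t
    induction p using MvPolynomial.induction_on' with
    | monomial u r =>
      rw [MvPolynomial.aeval_monomial, Finsupp.prod_fintype _ _ (by simp), Fin.prod_univ_two,
        ← Algebra.smul_def, map_smul, map_mul, map_pow, map_pow, AddMonoidAlgebra.coeff_smul,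
        Finsupp.smul_apply, MvPolynomial.coeff_monomial]
      simp only [Matrix.cons_val_zero, Matrix.cons_val_one, toLaurent_x, toLaurent_s]
      rw [mono_pow, mono_pow, mono_mul, coeff_mono]
      have : u = t ↔ u 1 = t 1 ∧ u 0 = t 0 := by
        rw [Finsupp.ext_iff, Fin.forall_fin_two, and_comm]
      simp [this]
    | add p q hp hq => simp [hp, hq]
  intro p q h
  ext t
  rw [← key, h, key]

end RRing

/-! ### Transport of derivations and restriction of automorphisms -/

/-- The derivation of `B` obtained from a derivation of `A` along an isomorphism. -/
def Derivation.transport {A B : Type*} [CommRing A] [Algebra k A] [CommRing B] [Algebra k B]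
    (α : A ≃ₐ[k] B) (D : Derivation k A A) : Derivation k B B :=
  Derivation.mk' (α.toLinearMap ∘ₗ (D : A →ₗ[k] A) ∘ₗ α.symm.toLinearMap) fun a b => by
    change α (D (α.symm (a * b))) = a * α (D (α.symm b)) + b * α (D (α.symm a))
    rw [_root_.map_mul, D.leibniz, _root_.map_add, smul_eq_mul, smul_eq_mul, _root_.map_mul,
      _root_.map_mul, α.apply_symm_apply, α.apply_symm_apply]

section Transport

variable {A B : Type*} [CommRing A] [Algebra k A] [CommRing B] [Algebra k B] (α : A ≃ₐ[k] B)
  (D : Derivation k A A)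

theorem Derivation.transport_apply (a : A) : D.transport α (α a) = α (D a) := by
  change α (D (α.symm (α a))) = _
  rw [α.symm_apply_apply]

theorem Derivation.transport_iterate (r : ℕ) (a : A) :
    (D.transport α)^[r] (α a) = α (D^[r] a) := by
  induction r generalizing a with
  | zero => rfl
  | succ r ih => rw [Function.iterate_succ_apply, D.transport_apply, ih,
      Function.iterate_succ_apply]

variable {D}

theorem IsLND.transport (hD : IsLND D) : IsLND (D.transport α) := by
  intro b
  obtain ⟨a, rfl⟩ := α.surjective b
  obtain ⟨N, hN⟩ := hD a
  exact ⟨N, by rw [D.transport_iterate, hN, map_zero]⟩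

theorem Derivation.transport_ne_zero (hD : D ≠ 0) : D.transport α ≠ 0 := by
  intro h
  refine hD (Derivation.ext fun a => α.injective ?_)
  rw [← D.transport_apply, h, Derivation.zero_apply, Derivation.zero_apply, _root_.map_zero]

end Transport

section Restriction

variable {A C : Type*} [CommRing A] [Algebra k A] [CommRing C] [Algebra k C]

theorem isInvariantSubalgebra_of_le {S : Subalgebra k A}
    (h : ∀ α : A ≃ₐ[k] A, S.map (α : A →ₐ[k] A) ≤ S) : IsInvariantSubalgebra S := by
  refine fun α => le_antisymm (h α) fun a ha => ?_
  exact ⟨α.symm a, h α.symm ⟨a, ha, rfl⟩, α.apply_symm_apply a⟩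

theorem isInvariantSubalgebra_adjoin {G : Set A}
    (h : ∀ α : A ≃ₐ[k] A, ∀ g ∈ G, α g ∈ Algebra.adjoin k G) :
    IsInvariantSubalgebra (Algebra.adjoin k G) := by
  refine isInvariantSubalgebra_of_le fun α => ?_
  rw [AlgHom.map_adjoin, Algebra.adjoin_le_iff]
  rintro _ ⟨g, hg, rfl⟩
  exact h α g hg

theorem IsInvariantSubalgebra.restrictsToAut {ι : C →ₐ[k] A} (hι : Function.Injective ι)
    (h : IsInvariantSubalgebra ι.range) (α : A ≃ₐ[k] A) : RestrictsToAut ι α := by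
  let e₁ : C ≃ₐ[k] ι.range := AlgEquiv.ofInjective ι hι
  refine ⟨(e₁.trans (α.subalgebraMap ι.range)).trans
    ((Subalgebra.equivOfEq _ _ (h α)).trans e₁.symm), fun c => ?_⟩
  have h1 : ∀ u : ι.range, ι (e₁.symm u) = u := fun u => by
    obtain ⟨c, rfl⟩ := e₁.surjective u
    rw [e₁.symm_apply_apply]
    rfl
  simp only [AlgEquiv.trans_apply]
  rw [h1]
  rfl

theorem restrictsToNonzeroLND_of_generators {ι : C →ₐ[k] A} (hι : Function.Injective ι)
    {D : Derivation k A A} (hD : IsLND D) {G : Set C} (hG : Algebra.adjoin k G = ⊤)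
    (h : ∀ g ∈ G, D (ι g) ∈ ι.range) {c : C} (hc : D (ι c) ≠ 0) :
    RestrictsToNonzeroLND ι D := by
  obtain ⟨D₀, hD₀⟩ := D.exists_restrict hι hG h
  have hit : ∀ (r : ℕ) (c : C), D^[r] (ι c) = ι (D₀^[r] c) := by
    intro r
    induction r with
    | zero => exact fun c => rfl
    | succ r ih => intro c; rw [Function.iterate_succ_apply, hD₀, ih, Function.iterate_succ_apply]
  refine ⟨D₀, fun c => ?_, ?_, hD₀⟩
  · obtain ⟨N, hN⟩ := hD (ι c)
    exact ⟨N, hι (by rw [← hit, hN, map_zero])⟩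
  · rintro rfl
    apply hc
    rw [hD₀, Derivation.zero_apply, map_zero]

end Restriction

/-! ### The invariants of `R_{n,e,P}` and the restriction of derivations -/

namespace RRing

section Invariants

variable [CharZero k] {n e m : ℕ} {P : Polynomial (Polynomial k)} (hP : P.Monic)
  (hd : 2 ≤ P.natDegree) (hm : 2 ≤ m) (hn : 1 ≤ n) (hne : (n, e) ≠ (1, 0))
include hP hd hm hn hne

/-- All nonzero locally nilpotent derivations share these kernels, so the union over `D` is attained
by the basic derivation alone. -/
theorem setOf_iterate_eq_zero (i : ℕ) :
    {a | ∃ D : Derivation k (RRing n e m P) (RRing n e m P),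
      IsLND D ∧ D ≠ 0 ∧ (⇑D)^[i + 1] a = 0} = degFil n e m P i := by
  ext a
  have hi : ((i + 1 : ℕ) : ℤ) - 1 = i := by simp
  constructor
  · rintro ⟨D, hD, hD0, h⟩
    rw [iterate_lnd_eq_zero_iff hP hd hm hn hne hD hD0, hi] at h
    exact h
  · intro h
    obtain ⟨E, hE⟩ := exists_derivation n e m P hP hd hm
    have hE : IsBasicDerivation E := hE
    refine ⟨E, hE.isLND hP hd hm, hE.ne_zero hP hd hm, ?_⟩
    rw [hE.iterate_eq_zero_iff hP hd hm, hi]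
    exact h

theorem ALi_eq (i : ℕ) : ALi k (RRing n e m P) i = degAdjoin n e m P i := by
  rw [ALi, setOf_iterate_eq_zero hP hd hm hn hne, degAdjoin]

theorem Derksen_eq : Derksen k (RRing n e m P) = degAdjoin n e m P 0 := by
  rw [← ALi_eq hP hd hm hn hne]
  rfl

theorem localSlices_eq {D : Derivation k (RRing n e m P) (RRing n e m P)} (hD : IsLND D)
    (hD0 : D ≠ 0) : localSlices D = degAdjoin n e m P 1 := by
  rw [localSlices, degAdjoin]
  congr 1
  ext a
  exact iterate_lnd_eq_zero_iff hP hd hm hn hne hD hD0 2 a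

theorem AL_eq : AL k (RRing n e m P) = degAdjoin n e m P 1 := by
  refine le_antisymm (Algebra.adjoin_le ?_) fun a ha => Algebra.subset_adjoin ?_
  · rintro a ⟨D, hD, hD0, h⟩
    rwa [localSlices_eq hP hd hm hn hne hD hD0] at h
  · obtain ⟨E, hE⟩ := exists_derivation n e m P hP hd hm
    have hE : IsBasicDerivation E := hE
    refine ⟨E, hE.isLND hP hd hm, hE.ne_zero hP hd hm, ?_⟩
    rwa [localSlices_eq hP hd hm hn hne (hE.isLND hP hd hm) (hE.ne_zero hP hd hm)]

theorem mem_ML_iff {a : RRing n e m P} : a ∈ ML k (RRing n e m P) ↔ a ∈ degFil n e m P 0 := by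
  constructor
  · intro h
    obtain ⟨E, hE⟩ := exists_derivation n e m P hP hd hm
    have hE : IsBasicDerivation E := hE
    exact (hE.iterate_eq_zero_iff hP hd hm 1 a).1 (h E (hE.isLND hP hd hm))
  · intro h D hD
    by_cases hD0 : D = 0
    · rw [hD0, Derivation.zero_apply]
    · exact (iterate_lnd_eq_zero_iff hP hd hm hn hne hD hD0 1 a).2 h

theorem ML_eq : ML k (RRing n e m P) = degAdjoin n e m P 0 := by
  refine le_antisymm (fun a ha => Algebra.subset_adjoin ?_) (Algebra.adjoin_le fun a ha => ?_)
  · exact (mem_ML_iff hP hd hm hn hne).1 ha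
  · exact (mem_ML_iff hP hd hm hn hne).2 ha

/-- Values of a locally nilpotent derivation on the generators. -/
theorem exists_lnd_values {D : Derivation k (RRing n e m P) (RRing n e m P)} (hD : IsLND D)
    (hD0 : D ≠ 0) : ∃ h ∈ Algebra.adjoin k {x n e m P}, D (x n e m P) = 0 ∧
      D (s n e m P) = h * x n e m P ^ (n + e) ∧ D (s n e m P) ≠ 0 ∧
      D (y n e m P) = h * (x n e m P ^ e *
        evalXS (Polynomial.derivative P) (x n e m P) (s n e m P)) ∧
      D (z n e m P) = h * ((m : RRing n e m P) * y n e m P ^ (m - 1) *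
        evalXS (Polynomial.derivative P) (x n e m P) (s n e m P) - x n e m P ^ n) := by
  have := isDomain (n := n) (e := e) hP hd hm
  obtain ⟨E, hE⟩ := exists_derivation n e m P hP hd hm
  have hE : IsBasicDerivation E := hE
  obtain ⟨h, rfl⟩ := lnd_eq_smul hP hd hm hn hne hE hD
  obtain ⟨h1, h2⟩ := E.map_of_relation x_ne_zero (hE.map_x hP hd hm) (hE.map_s hP hd hm)
    (relation n e m P) (z := z n e m P) (m := m) (by rw [s]; ring)
  refine ⟨_, Polynomial.aeval_mem_adjoin_singleton k _ (p := h), ?_, ?_, ?_, ?_, ?_⟩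
  · rw [Derivation.smul_apply, hE.map_x hP hd hm, smul_zero]
  · rw [Derivation.smul_apply, hE.map_s hP hd hm, smul_eq_mul]
  · intro h0
    have := (iterate_lnd_eq_zero_iff hP hd hm hn hne hD hD0 1 _).1 h0
    exact s_notMem_degFil this
  · rw [Derivation.smul_apply, h1, smul_eq_mul]
  · rw [Derivation.smul_apply, h2, smul_eq_mul]

theorem rEmb_restrictsToNonzeroLND {e₀ : ℕ} (h : e₀ ≤ e)
    {D : Derivation k (RRing n e m P) (RRing n e m P)} (hD : IsLND D) (hD0 : D ≠ 0) :
    RestrictsToNonzeroLND (rEmb n h m P) D := by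
  obtain ⟨a, ha, hx, hs, hs0, hy, hz⟩ := exists_lnd_values hP hd hm hn hne hD hD0
  have hxR : x n e m P ∈ (rEmb n h m P).range := ⟨_, rEmb_x h⟩
  have hyR : y n e m P ∈ (rEmb n h m P).range := ⟨_, rEmb_y h⟩
  have hsR : s n e m P ∈ (rEmb n h m P).range := ⟨_, rEmb_s h⟩
  have haR : a ∈ (rEmb n h m P).range :=
    (Algebra.adjoin_le (by rintro b rfl; exact hxR) : Algebra.adjoin k {x n e m P} ≤ _) ha
  have hPR := evalXS_mem hxR hsR (Polynomial.derivative P)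
  refine restrictsToNonzeroLND_of_generators (rEmb_injective hP hd hm h) hD adjoin_eq_top ?_
    (c := s n e₀ m P) (by rwa [rEmb_s])
  rintro g (rfl | rfl | rfl)
  · rw [rEmb_x, hx]
    exact zero_mem _
  · rw [rEmb_y, hy]
    exact mul_mem haR (mul_mem (pow_mem hxR _) hPR)
  · rw [rEmb_z, D.leibniz, D.leibniz_pow, hx, hz]
    simp only [smul_eq_mul, mul_zero, smul_zero, add_zero]
    refine mul_mem (pow_mem hxR _) (mul_mem haR (sub_mem (mul_mem (mul_mem ?_ (pow_mem hyR _)) hPR)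
      (pow_mem hxR _)))
    exact natCast_mem _ m

theorem bEmb_restrictsToNonzeroLND {n₀ : ℕ} (h : n₀ ≤ n)
    {D : Derivation k (RRing n e m P) (RRing n e m P)} (hD : IsLND D) (hD0 : D ≠ 0) :
    RestrictsToNonzeroLND (bEmb h e m P) D := by
  obtain ⟨a, ha, hx, hs, hs0, hy, -⟩ := exists_lnd_values hP hd hm hn hne hD hD0
  have hxR : x n e m P ∈ (bEmb h e m P).range := ⟨_, bEmb_x h⟩
  have hsR : s n e m P ∈ (bEmb h e m P).range := ⟨_, bEmb_s h⟩
  have haR : a ∈ (bEmb h e m P).range :=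
    (Algebra.adjoin_le (by rintro b rfl; exact hxR) : Algebra.adjoin k {x n e m P} ≤ _) ha
  have hPR := evalXS_mem hxR hsR (Polynomial.derivative P)
  refine restrictsToNonzeroLND_of_generators (bEmb_injective hP hd hm h) hD BRing.adjoin_eq_top ?_
    (c := BRing.s n₀ P) (by rwa [bEmb_s])
  rintro g (rfl | rfl | rfl)
  · rw [bEmb_x, hx]
    exact zero_mem _
  · rw [bEmb_s, hs]
    exact mul_mem haR (pow_mem hxR _)
  · rw [bEmb_y, D.leibniz, D.leibniz_pow, hx, hy]
    simp only [smul_eq_mul, mul_zero, smul_zero, add_zero]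
    exact mul_mem (pow_mem hxR _) (mul_mem haR (mul_mem (pow_mem hxR _) hPR))

end Invariants

/-! ### Isomorphisms -/

section Isomorphisms

variable [CharZero k] {n₁ e₁ n₂ e₂ m : ℕ} {P : Polynomial (Polynomial k)}

/-- The basic derivation of the source is transported to the target, where every nonzero locally
nilpotent derivation defines the degree filtration. Only the target has to differ from the
exceptional ring. -/
theorem map_mem_degFil_iff (hP : P.Monic) (hd : 2 ≤ P.natDegree) (hm : 2 ≤ m) (hn₂ : 1 ≤ n₂)
    (hne₂ : (n₂, e₂) ≠ (1, 0)) (α : RRing n₁ e₁ m P ≃ₐ[k] RRing n₂ e₂ m P) {N : ℕ}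
    {a : RRing n₁ e₁ m P} : α a ∈ degFil n₂ e₂ m P N ↔ a ∈ degFil n₁ e₁ m P N := by
  obtain ⟨E, hE⟩ := exists_derivation n₁ e₁ m P hP hd hm
  have hE : IsBasicDerivation E := hE
  have h1 := iterate_lnd_eq_zero_iff hP hd hm hn₂ hne₂ ((hE.isLND hP hd hm).transport α)
    (Derivation.transport_ne_zero α (hE.ne_zero hP hd hm)) (N + 1) (α a)
  have h2 := hE.iterate_eq_zero_iff hP hd hm (N + 1) a
  have hN : ((N + 1 : ℕ) : ℤ) - 1 = N := by simp
  rw [hN] at h1 h2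
  rw [← h1, ← h2, E.transport_iterate, map_eq_zero_iff α α.injective]

theorem map_degAdjoin (hP : P.Monic) (hd : 2 ≤ P.natDegree) (hm : 2 ≤ m) (hn₂ : 1 ≤ n₂)
    (hne₂ : (n₂, e₂) ≠ (1, 0)) (α : RRing n₁ e₁ m P ≃ₐ[k] RRing n₂ e₂ m P) (N : ℕ) :
    (degAdjoin n₁ e₁ m P N).map (α : RRing n₁ e₁ m P →ₐ[k] RRing n₂ e₂ m P) =
      degAdjoin n₂ e₂ m P N := by
  rw [degAdjoin, degAdjoin, AlgHom.map_adjoin]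
  congr 1
  ext b
  constructor
  · rintro ⟨a, ha, rfl⟩
    exact (map_mem_degFil_iff hP hd hm hn₂ hne₂ α).2 ha
  · intro hb
    obtain ⟨a, rfl⟩ := α.surjective b
    exact ⟨a, (map_mem_degFil_iff hP hd hm hn₂ hne₂ α).1 hb, rfl⟩

theorem IsBasicDerivation.map_degFil_one {n e : ℕ} (hP : P.Monic) (hd : 2 ≤ P.natDegree)
    (hm : 2 ≤ m) {E : Derivation k (RRing n e m P) (RRing n e m P)} (hE : IsBasicDerivation E)
    {a : RRing n e m P} (ha : a ∈ degFil n e m P 1) :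
    ∃ g : Polynomial k, E a = Polynomial.aeval (x n e m P) (g * Polynomial.X ^ (n + e)) := by
  obtain ⟨q, r, hr, rfl⟩ := mem_degFil_succ (N := 1) hP hd hm ha
  have hker : ∀ b ∈ degFil n e m P 0, E b = 0 :=
    fun b hb => (hE.iterate_eq_zero_iff hP hd hm 1 b).2 hb
  have h1 : monomial n e m P 1 = s n e m P := by
    rw [monomial, Nat.mod_eq_of_lt (by lia), Nat.div_eq_of_lt (by lia)]
    simp
  refine ⟨q, ?_⟩
  rw [map_add, hker r hr, E.leibniz, hker _ ((mem_degFil_zero_iff hP hd hm).2 ⟨q, rfl⟩), h1,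
    hE.map_s hP hd hm]
  simp

/-- The transport of `E₁` is `h * E₂`. Evaluated at `α s`, which has degree at most one, it gives
`α(x) ^ (n₁ + e₁)` on one side and a multiple of `x ^ (n₂ + e₂)` on the other. -/
theorem exists_dvd_map_x (hP : P.Monic) (hd : 2 ≤ P.natDegree) (hm : 2 ≤ m) (hn₂ : 1 ≤ n₂)
    (hne₂ : (n₂, e₂) ≠ (1, 0)) (α : RRing n₁ e₁ m P ≃ₐ[k] RRing n₂ e₂ m P) :
    ∃ f : Polynomial k, α (x n₁ e₁ m P) = Polynomial.aeval (x n₂ e₂ m P) (Polynomial.X * f) ∧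
      (Polynomial.X : Polynomial k) ^ (n₂ + e₂) ∣ (Polynomial.X * f) ^ (n₁ + e₁) := by
  obtain ⟨E₁, hE₁⟩ := exists_derivation n₁ e₁ m P hP hd hm
  have hE₁ : IsBasicDerivation E₁ := hE₁
  obtain ⟨E₂, hE₂⟩ := exists_derivation n₂ e₂ m P hP hd hm
  have hE₂ : IsBasicDerivation E₂ := hE₂
  obtain ⟨f₀, hf₀⟩ := (mem_degFil_zero_iff hP hd hm).1
    ((map_mem_degFil_iff (N := 0) hP hd hm hn₂ hne₂ α).2 x_mem_degFil)
  obtain ⟨h, hh⟩ := lnd_eq_smul hP hd hm hn₂ hne₂ hE₂ ((hE₁.isLND hP hd hm).transport α)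
  obtain ⟨g, hg⟩ := hE₂.map_degFil_one hP hd hm
    ((map_mem_degFil_iff (N := 1) hP hd hm hn₂ hne₂ α).2 s_mem_degFil)
  have h1 := E₁.transport_apply α (s n₁ e₁ m P)
  rw [hE₁.map_s hP hd hm, hh, Derivation.smul_apply, hg, map_pow, hf₀, smul_eq_mul, ← map_mul,
    ← map_pow] at h1
  have h2 := aeval_x_injective h1
  have h3 : (Polynomial.X : Polynomial k) ^ (n₂ + e₂) ∣ f₀ ^ (n₁ + e₁) :=
    ⟨h * g, by rw [← h2]; ring⟩
  have h4 : (Polynomial.X : Polynomial k) ∣ f₀ :=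
    Polynomial.prime_X.dvd_of_dvd_pow ((dvd_pow_self _ (by lia)).trans h3)
  obtain ⟨f, rfl⟩ := h4
  exact ⟨f, hf₀, h3⟩

/-- Applying `exists_dvd_map_x` to `α` and to its inverse shows that `α x` is a unit times `x`, so
the divisibility there compares powers of `x`. -/
theorem add_le_add_of_algEquiv (hP : P.Monic) (hd : 2 ≤ P.natDegree) (hm : 2 ≤ m) (hn₁ : 1 ≤ n₁)
    (hne₁ : (n₁, e₁) ≠ (1, 0)) (hn₂ : 1 ≤ n₂) (hne₂ : (n₂, e₂) ≠ (1, 0))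
    (α : RRing n₁ e₁ m P ≃ₐ[k] RRing n₂ e₂ m P) :
    n₂ + e₂ ≤ n₁ + e₁ := by
  obtain ⟨f, hf, hdvd⟩ := exists_dvd_map_x hP hd hm hn₂ hne₂ α
  obtain ⟨g, hg, -⟩ := exists_dvd_map_x hP hd hm hn₁ hne₁ α.symm
  have h1 : x n₂ e₂ m P = Polynomial.aeval (x n₂ e₂ m P) ((Polynomial.X * g).comp
      (Polynomial.X * f)) := by
    conv_lhs => rw [← α.apply_symm_apply (x n₂ e₂ m P), hg]
    rw [Polynomial.aeval_comp, ← hf]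
    exact (Polynomial.aeval_algHom_apply (α : RRing n₁ e₁ m P →ₐ[k] RRing n₂ e₂ m P) _ _).symm
  have h2 : (Polynomial.X : Polynomial k) = (Polynomial.X * g).comp (Polynomial.X * f) :=
    aeval_x_injective (n := n₂) (e := e₂) (m := m) (P := P) (by rw [Polynomial.aeval_X]; exact h1)
  rw [Polynomial.mul_comp, Polynomial.X_comp, mul_assoc, eq_comm,
    mul_eq_left₀ Polynomial.X_ne_zero] at h2
  have hfu : IsUnit f := IsUnit.of_mul_eq_one _ h2
  rw [mul_pow, (hfu.pow _).dvd_mul_right] at hdvd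
  exact (pow_dvd_pow_iff Polynomial.X_ne_zero Polynomial.not_isUnit_X).1 hdvd

end Isomorphisms

/-! ### Automorphisms and the invariance of the chain -/

section Automorphisms

variable [CharZero k] {n e m : ℕ} {P : Polynomial (Polynomial k)} (hP : P.Monic)
  (hd : 2 ≤ P.natDegree) (hm : 2 ≤ m) (hn : 1 ≤ n) (hne : (n, e) ≠ (1, 0))
include hP hd hm hn hne

theorem isInvariantSubalgebra_degAdjoin (N : ℕ) :
    IsInvariantSubalgebra (degAdjoin n e m P N) :=
  fun α => map_degAdjoin hP hd hm hn hne α N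

theorem exists_map_x (α : RRing n e m P ≃ₐ[k] RRing n e m P) :
    ∃ g ∈ Algebra.adjoin k {x n e m P}, α (x n e m P) = x n e m P * g := by
  obtain ⟨f, hf, -⟩ := exists_dvd_map_x hP hd hm hn hne α
  exact ⟨_, Polynomial.aeval_mem_adjoin_singleton k _ (p := f), by
    rw [hf, map_mul, Polynomial.aeval_X]⟩

theorem map_s_mem (α : RRing n e m P ≃ₐ[k] RRing n e m P) :
    α (s n e m P) ∈ Algebra.adjoin k {x n e m P, s n e m P} :=
  degFil_le_adjoin_xs (N := 1) hP hd hm (by lia)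
    ((map_mem_degFil_iff (N := 1) hP hd hm hn hne α).2 s_mem_degFil)

theorem exists_map_y (α : RRing n e m P ≃ₐ[k] RRing n e m P) :
    ∃ q ∈ Algebra.adjoin k {x n e m P}, ∃ r ∈ Algebra.adjoin k {x n e m P, s n e m P},
      α (y n e m P) = q * y n e m P + r := by
  obtain ⟨q, r, hr, h⟩ := mem_degFil_succ hP hd hm
    ((map_mem_degFil_iff hP hd hm hn hne α).2 (y_mem_degFil hP))
  rw [monomial_natDegree hd hm] at h
  refine ⟨_, Polynomial.aeval_mem_adjoin_singleton k _ (p := q), r, ?_, h⟩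
  exact degFil_le_adjoin_xs (N := P.natDegree - 1) hP hd hm (by lia) (degFil_mono (by lia) hr)

theorem exists_map_z (α : RRing n e m P ≃ₐ[k] RRing n e m P) :
    ∃ q ∈ Algebra.adjoin k {x n e m P}, ∃ r ∈ Algebra.adjoin k {x n e m P, s n e m P, y n e m P},
      α (z n e m P) = q * z n e m P + r := by
  have hz := z_mem_degFil (n := n) (e := e) hP hd hm
  rw [← Nat.cast_mul] at hz
  obtain ⟨q, r, hr, h⟩ := mem_degFil_succ hP hd hm
    ((map_mem_degFil_iff hP hd hm hn hne α).2 hz)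
  rw [monomial_mul_natDegree_eq_z hd hm] at h
  have hpos : 0 < m * P.natDegree := by positivity
  refine ⟨_, Polynomial.aeval_mem_adjoin_singleton k _ (p := q), r, ?_, h⟩
  exact degFil_le_adjoin_xsy (N := m * P.natDegree - 1) hP hd hm (by lia)
    (degFil_mono (by lia) hr)

theorem isInvariantSubalgebra_bEmb {n₀ : ℕ} (h : n₀ ≤ n) :
    IsInvariantSubalgebra (bEmb h e m P).range := by
  rw [bEmb_range]
  refine isInvariantSubalgebra_adjoin fun α => ?_
  set S := Algebra.adjoin k {x n e m P, s n e m P, x n e m P ^ (n - n₀) * y n e m P}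
  have hxS : x n e m P ∈ S := Algebra.subset_adjoin (by simp)
  have hsS : s n e m P ∈ S := Algebra.subset_adjoin (by simp)
  have hyS : x n e m P ^ (n - n₀) * y n e m P ∈ S := Algebra.subset_adjoin (by simp)
  have h1 : Algebra.adjoin k {x n e m P} ≤ S := Algebra.adjoin_le (by rintro _ rfl; exact hxS)
  have h2 : Algebra.adjoin k {x n e m P, s n e m P} ≤ S :=
    Algebra.adjoin_le (by rintro _ (rfl | rfl) <;> assumption)
  obtain ⟨g, hg, hαx⟩ := exists_map_x hP hd hm hn hne α
  obtain ⟨q, hq, r, hr, hαy⟩ := exists_map_y hP hd hm hn hne α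
  rintro _ (rfl | rfl | rfl)
  · rw [hαx]
    exact mul_mem hxS (h1 hg)
  · exact h2 (map_s_mem hP hd hm hn hne α)
  · have : α (x n e m P ^ (n - n₀) * y n e m P) = g ^ (n - n₀) *
        (q * (x n e m P ^ (n - n₀) * y n e m P) + x n e m P ^ (n - n₀) * r) := by
      rw [map_mul, map_pow, hαx, hαy]
      ring
    rw [this]
    exact mul_mem (pow_mem (h1 hg) _) (add_mem (mul_mem (h1 hq) hyS)
      (mul_mem (pow_mem hxS _) (h2 hr)))

theorem isInvariantSubalgebra_rEmb {e₀ : ℕ} (h : e₀ ≤ e) :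
    IsInvariantSubalgebra (rEmb n h m P).range := by
  have hsR : s n e m P ∈ (rEmb n h m P).range := ⟨_, rEmb_s h⟩
  rw [rEmb_range] at hsR ⊢
  refine isInvariantSubalgebra_adjoin fun α => ?_
  set S := Algebra.adjoin k {x n e m P, y n e m P, x n e m P ^ (e - e₀) * z n e m P}
  have hxS : x n e m P ∈ S := Algebra.subset_adjoin (by simp)
  have hyS : y n e m P ∈ S := Algebra.subset_adjoin (by simp)
  have hzS : x n e m P ^ (e - e₀) * z n e m P ∈ S := Algebra.subset_adjoin (by simp)
  have h1 : Algebra.adjoin k {x n e m P} ≤ S := Algebra.adjoin_le (by rintro _ rfl; exact hxS)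
  have h2 : Algebra.adjoin k {x n e m P, s n e m P} ≤ S :=
    Algebra.adjoin_le (by rintro _ (rfl | rfl) <;> assumption)
  have h3 : Algebra.adjoin k {x n e m P, s n e m P, y n e m P} ≤ S :=
    Algebra.adjoin_le (by rintro _ (rfl | rfl | rfl) <;> assumption)
  obtain ⟨g, hg, hαx⟩ := exists_map_x hP hd hm hn hne α
  obtain ⟨q, hq, r, hr, hαy⟩ := exists_map_y hP hd hm hn hne α
  obtain ⟨q', hq', r', hr', hαz⟩ := exists_map_z hP hd hm hn hne α
  rintro _ (rfl | rfl | rfl)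
  · rw [hαx]
    exact mul_mem hxS (h1 hg)
  · rw [hαy]
    exact add_mem (mul_mem (h1 hq) hyS) (h2 hr)
  · have : α (x n e m P ^ (e - e₀) * z n e m P) = g ^ (e - e₀) *
        (q' * (x n e m P ^ (e - e₀) * z n e m P) + x n e m P ^ (e - e₀) * r') := by
      rw [map_mul, map_pow, hαx, hαz]
      ring
    rw [this]
    exact mul_mem (pow_mem (h1 hg) _) (add_mem (mul_mem (h1 hq') hzS)
      (mul_mem (pow_mem hxS _) (h3 hr')))

end Automorphisms

end RRing

/-! ### The exceptional ring `R_{1,0,P}` and the isomorphism classes -/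

theorem exists_eq_add_C_X_mul (P : Polynomial (Polynomial k)) :
    ∃ Q, P = P.map (Polynomial.C.comp Polynomial.constantCoeff) +
      Polynomial.C Polynomial.X * Q := by
  have h : Polynomial.C Polynomial.X ∣
      P - P.map (Polynomial.C.comp Polynomial.constantCoeff) := by
    rw [Polynomial.C_dvd_iff_dvd_coeff]
    intro i
    rw [Polynomial.coeff_sub, Polynomial.coeff_map, Polynomial.X_dvd_iff]
    simp
  obtain ⟨Q, hQ⟩ := h
  exact ⟨Q, by rw [← hQ]; ring⟩

theorem evalXS_add_C_X_mul {A : Type*} [CommRing A] [Algebra k A]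
    (P Q : Polynomial (Polynomial k)) (x s : A) :
    evalXS (P + Polynomial.C Polynomial.X * Q) x s = evalXS P x s + x * evalXS Q x s := by
  have h : (Polynomial.aeval x : Polynomial k →ₐ[k] A).toRingHom Polynomial.X = x :=
    Polynomial.aeval_X x
  rw [evalXS, Polynomial.eval₂_add, Polynomial.eval₂_mul, Polynomial.eval₂_C, h]
  rfl

theorem evalXS_map_constantCoeff {A : Type*} [CommRing A] [Algebra k A]
    (P : Polynomial (Polynomial k)) (x x' s : A) :
    evalXS (P.map (Polynomial.C.comp Polynomial.constantCoeff)) x s =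
      evalXS (P.map (Polynomial.C.comp Polynomial.constantCoeff)) x' s := by
  have h : ∀ u : A, (Polynomial.aeval u : Polynomial k →ₐ[k] A).toRingHom.comp Polynomial.C =
      algebraMap k A := fun u => RingHom.ext fun r => Polynomial.aeval_C u r
  rw [evalXS, evalXS, Polynomial.eval₂_map, Polynomial.eval₂_map, ← RingHom.comp_assoc,
    ← RingHom.comp_assoc, h, h]

namespace RRing

variable {m : ℕ} {P : Polynomial (Polynomial k)}

/-- The ring `R_{1,0,P}` has an automorphism moving `x` out of the kernel of `d/ds`. -/
theorem exists_algEquiv_map_x_notMem (hP : P.Monic) (hd : 0 < P.natDegree) :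
    ∃ σ : RRing 1 0 m P ≃ₐ[k] RRing 1 0 m P, σ (x 1 0 m P) ∉ degFil 1 0 m P 0 := by
  obtain ⟨Q, hQ⟩ := exists_eq_add_C_X_mul P
  set P₀ := P.map (Polynomial.C.comp Polynomial.constantCoeff) with hP₀
  have hval : ∀ u v w : RRing 1 0 m P,
      evalXS P u v = evalXS P₀ w v + u * evalXS Q u v := by
    intro u v w
    rw [congrArg (fun p => evalXS p u v) hQ, evalXS_add_C_X_mul, hP₀, evalXS_map_constantCoeff P u w]
  set X := x 1 0 m P
  set Y := y 1 0 m P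
  set S := s 1 0 m P with hS
  -- With `P = P₀(S) + X * Q`, the relation `X * Y = P` becomes `X * W = P₀(S)`, which is symmetric
  -- in `X` and `W`; `σ` exchanges these two and fixes `S`.
  set W := Y - evalXS Q X S with hW
  have hXW : X * W = evalXS P₀ X S := by
    have := relation 1 0 m P
    rw [pow_one] at this
    rw [hW, mul_sub, this, hval X S X]
    ring
  have hZ : z 1 0 m P = Y ^ m - S := by
    rw [hS, s, pow_zero, one_mul, sub_sub_cancel]
  let σ : RRing 1 0 m P →ₐ[k] RRing 1 0 m P :=
    lift W (X + evalXS Q W S) ((X + evalXS Q W S) ^ m - S) (by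
      rw [pow_zero, one_mul, sub_sub_cancel, hval W S X, ← hXW, pow_one]
      ring)
  have hσX : σ X = W := lift_x _ _ _ _
  have hσY : σ Y = X + evalXS Q W S := lift_y _ _ _ _
  have hσZ : σ (z 1 0 m P) = (X + evalXS Q W S) ^ m - S := lift_z _ _ _ _
  have hσS : σ S = S := by
    refine (lift_s _ _ _ _).trans ?_
    rw [pow_zero, one_mul, sub_sub_cancel]
  have hσW : σ W = X := by
    rw [hW, map_sub, map_evalXS, hσX, hσY, hσS, add_sub_cancel_right]
  have hσσ : σ.comp σ = AlgHom.id k _ := by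
    have hσσY : σ (X + evalXS Q W S) = Y := by
      rw [map_add, map_evalXS, hσX, hσW, hσS, hW, sub_add_cancel]
    refine algHom_ext' ?_ ?_ ?_
    · exact (congrArg σ hσX).trans hσW
    · exact (congrArg σ hσY).trans hσσY
    · refine (congrArg σ hσZ).trans ?_
      rw [map_sub, map_pow, hσσY, hσS]
      exact hZ.symm
  refine ⟨AlgEquiv.ofAlgHom σ σ hσσ hσσ, ?_⟩
  change σ X ∉ _
  rw [hσX]
  intro hmem
  have hmonic : P₀.Monic := hP.map _
  have hlead := hasLead_evalXS hmonic
  rw [hP.natDegree_map] at hlead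
  -- If `W` had degree at most zero, so would `X * W = P₀(S)`, which has degree `d`.
  have hx0 : X ∈ degFil 1 0 m P 0 := x_mem_degFil
  have h1 : toLaurent 1 0 m P (X * W) ∈ degLE k (0 + 0) := by
    rw [map_mul]
    exact mul_mem_degLE hx0 hmem
  rw [hXW, map_evalXS, toLaurent_x, toLaurent_s] at h1
  have h2 := h1 (P.natDegree, 0) (by simpa using hd)
  rw [hlead.coeff, if_pos rfl] at h2
  exact one_ne_zero h2

theorem natDegree_lt_mul (hd : 2 ≤ P.natDegree) (hm : 2 ≤ m) :
    P.natDegree < m * P.natDegree := by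
  have := Nat.mul_le_mul_right P.natDegree hm
  lia

theorem bToR_injective (hP : P.Monic) (hd : 2 ≤ P.natDegree) (hm : 2 ≤ m) (n e : ℕ) :
    Function.Injective (bToR n e m P) := by
  rw [bToR_eq_bEmb]
  exact bEmb_injective hP hd hm le_rfl

variable [CharZero k] {n₁ e₁ n₂ e₂ : ℕ}

/-- An isomorphism `α` and its composite with `σ⁻¹` would both preserve the degree filtration, and
hence so would `σ`, which moves `x` out of degree zero. -/
theorem not_nonempty_algEquiv_one_zero (hP : P.Monic) (hd : 2 ≤ P.natDegree) (hm : 2 ≤ m)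
    (hn₂ : 1 ≤ n₂) (hne₂ : (n₂, e₂) ≠ (1, 0)) :
    ¬ Nonempty (RRing 1 0 m P ≃ₐ[k] RRing n₂ e₂ m P) := by
  rintro ⟨α⟩
  obtain ⟨σ, hσ⟩ := exists_algEquiv_map_x_notMem (m := m) hP (by lia)
  apply hσ
  have h1 := (map_mem_degFil_iff (N := 0) hP hd hm hn₂ hne₂ (σ.symm.trans α)
    (a := σ (x 1 0 m P))).1
  refine h1 ?_
  rw [AlgEquiv.trans_apply, AlgEquiv.symm_apply_apply]
  exact (map_mem_degFil_iff (N := 0) hP hd hm hn₂ hne₂ α).2 x_mem_degFil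

theorem add_eq_add_of_algEquiv (hP : P.Monic) (hd : 2 ≤ P.natDegree) (hm : 2 ≤ m)
    (hn₁ : 1 ≤ n₁) (hn₂ : 1 ≤ n₂) (α : RRing n₁ e₁ m P ≃ₐ[k] RRing n₂ e₂ m P) :
    n₁ + e₁ = n₂ + e₂ := by
  by_cases h₁ : (n₁, e₁) = (1, 0) <;> by_cases h₂ : (n₂, e₂) = (1, 0)
  · simp only [Prod.mk.injEq] at h₁ h₂
    lia
  · obtain ⟨rfl, rfl⟩ := Prod.mk.injEq .. ▸ h₁
    exact absurd ⟨α⟩ (not_nonempty_algEquiv_one_zero hP hd hm hn₂ h₂)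
  · obtain ⟨rfl, rfl⟩ := Prod.mk.injEq .. ▸ h₂
    exact absurd ⟨α.symm⟩ (not_nonempty_algEquiv_one_zero hP hd hm hn₁ h₁)
  · exact le_antisymm (add_le_add_of_algEquiv hP hd hm hn₂ h₂ hn₁ h₁ α.symm)
      (add_le_add_of_algEquiv hP hd hm hn₁ h₁ hn₂ h₂ α)

/-- An isomorphism between the rings `R` induces one between the rings `B`. -/
theorem nonempty_bEquiv (hP : P.Monic) (hd : 2 ≤ P.natDegree) (hm : 2 ≤ m) (hn₂ : 1 ≤ n₂)
    (hne₂ : (n₂, e₂) ≠ (1, 0)) (α : RRing n₁ e₁ m P ≃ₐ[k] RRing n₂ e₂ m P) :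
    Nonempty (RRing n₁ 0 m P ≃ₐ[k] RRing n₂ 0 m P) := by
  -- The elements of degree at most `d` generate the image of `B_{n,P}`, because `d < m * d`.
  have h := map_degAdjoin hP hd hm hn₂ hne₂ α P.natDegree
  rw [degAdjoin_of_lt_mul hP hd hm le_rfl (natDegree_lt_mul hd hm),
    degAdjoin_of_lt_mul hP hd hm le_rfl (natDegree_lt_mul hd hm)] at h
  exact ⟨(bEquivR n₁ m P).symm.trans <|
    (AlgEquiv.ofInjective _ (bToR_injective hP hd hm n₁ e₁)).trans <|
    (α.subalgebraMap _).trans <| (Subalgebra.equivOfEq _ _ h).trans <|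
    (AlgEquiv.ofInjective _ (bToR_injective hP hd hm n₂ e₂)).symm.trans (bEquivR n₂ m P)⟩

theorem nonempty_algEquiv_iff (hP : P.Monic) (hd : 2 ≤ P.natDegree) (hm : 2 ≤ m)
    (hn₁ : 1 ≤ n₁) (hn₂ : 1 ≤ n₂) :
    Nonempty (RRing n₁ e₁ m P ≃ₐ[k] RRing n₂ e₂ m P) ↔ n₁ = n₂ ∧ e₁ = e₂ := by
  constructor
  · rintro ⟨α⟩
    have h := add_eq_add_of_algEquiv hP hd hm hn₁ hn₂ α
    by_cases h₂ : (n₂, e₂) = (1, 0)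
    · simp only [Prod.mk.injEq] at h₂
      lia
    -- The sum `n + e` is compared twice: for the rings themselves and, with `e = 0`, for their
    -- subrings `B`, which isolates `n`.
    · obtain ⟨β⟩ := nonempty_bEquiv hP hd hm hn₂ h₂ α
      have h' := add_eq_add_of_algEquiv hP hd hm hn₁ hn₂ β
      lia
  · rintro ⟨rfl, rfl⟩
    exact ⟨AlgEquiv.refl⟩

end RRing

end

theorem mainTheorem9 {k : Type*} [Field k] [CharZero k] (n e d m : ℕ)
    (P : Polynomial (Polynomial k))
    (hn : 1 ≤ n) (hne : (n, e) ≠ (1, 0)) (hd : 2 ≤ d) (hm : 2 ≤ m)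
    (hP : P.Monic) (hPd : P.natDegree = d) :
    -- the chain `B_{1,P} ⊂ ... ⊂ B_{n,P} ⊂ R_{n,1,P} ⊂ ... ⊂ R_{n,e,P}`
    ((∀ (n₀ : ℕ) (h : n₀ ≤ n), Function.Injective (bEmb h e m P)) ∧
      (∀ (e₀ : ℕ) (h : e₀ ≤ e), Function.Injective (rEmb n h m P)) ∧
      (∀ (n₀ n₁ : ℕ) (h₀ : n₀ ≤ n₁) (h₁ : n₁ ≤ n),
        (bEmb (h₀.trans h₁) e m P).range ≤ (bEmb h₁ e m P).range) ∧
      (∀ (e₀ : ℕ) (h : e₀ ≤ e), (bEmb le_rfl e m P).range ≤ (rEmb n h m P).range) ∧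
      (∀ (e₀ e₁ : ℕ) (h₀ : e₀ ≤ e₁) (h₁ : e₁ ≤ e),
        (rEmb n (h₀.trans h₁) m P).range ≤ (rEmb n h₁ m P).range) ∧
      Function.Bijective (bToR n 0 m P)) ∧
    -- (a)
    (∀ D : Derivation k (RRing n e m P) (RRing n e m P), IsLND D → D ≠ 0 →
      (∀ (e₀ : ℕ) (h : e₀ ≤ e), 1 ≤ e₀ → RestrictsToNonzeroLND (rEmb n h m P) D) ∧
      (∀ (n₀ : ℕ) (h : n₀ ≤ n), RestrictsToNonzeroLND (bEmb h e m P) D)) ∧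
    -- (b)
    (∀ α : RRing n e m P ≃ₐ[k] RRing n e m P,
      (∀ (e₀ : ℕ) (h : e₀ ≤ e), 1 ≤ e₀ → RestrictsToAut (rEmb n h m P) α) ∧
      (∀ (n₀ : ℕ) (h : n₀ ≤ n), 1 ≤ n₀ → RestrictsToAut (bEmb h e m P) α)) ∧
    -- (c)
    (∀ n₁ e₁ n₂ e₂ : ℕ, 1 ≤ n₁ → 1 ≤ n₂ →
      (Nonempty (RRing n₁ e₁ m P ≃ₐ[k] RRing n₂ e₂ m P) ↔ n₁ = n₂ ∧ e₁ = e₂)) ∧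
    -- (d)
    (ML k (RRing n e m P) = Algebra.adjoin k {RRing.x n e m P} ∧
      AL k (RRing n e m P) = Algebra.adjoin k {RRing.x n e m P, RRing.s n e m P} ∧
      AlgebraicIndependent k ![RRing.x n e m P, RRing.s n e m P] ∧
      IsInvariantSubalgebra (ML k (RRing n e m P)) ∧
      IsInvariantSubalgebra (AL k (RRing n e m P)) ∧
      (∀ (n₀ : ℕ) (h : n₀ ≤ n), 1 ≤ n₀ → IsInvariantSubalgebra (bEmb h e m P).range) ∧
      (∀ (e₀ : ℕ) (h : e₀ ≤ e), 1 ≤ e₀ → IsInvariantSubalgebra (rEmb n h m P).range)) ∧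
    -- (e)
    (ALi k (RRing n e m P) 0 = Derksen k (RRing n e m P) ∧
      Derksen k (RRing n e m P) = ML k (RRing n e m P) ∧
      ML k (RRing n e m P) < AL k (RRing n e m P) ∧
      (∀ i : ℕ, 1 ≤ i → i ≤ d - 1 → ALi k (RRing n e m P) i = AL k (RRing n e m P)) ∧
      AL k (RRing n e m P) < (bToR n e m P).range ∧
      (∀ i : ℕ, d ≤ i → i ≤ m * d - 1 → ALi k (RRing n e m P) i = (bToR n e m P).range) ∧
      (1 ≤ e → (bToR n e m P).range < ALi k (RRing n e m P) (m * d)) ∧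
      ALi k (RRing n e m P) (m * d) = ⊤) := by
  subst hPd
  have hlt := RRing.natDegree_lt_mul hd hm
  have hALi := RRing.ALi_eq hP hd hm hn hne
  have hML := RRing.ML_eq hP hd hm hn hne
  have hAL := RRing.AL_eq hP hd hm hn hne
  have h1 := RRing.degAdjoin_of_lt (n := n) (e := e) (N := 1) hP hd hm le_rfl hd
  have hB : (bToR n e m P).range = (bEmb (le_refl n) e m P).range := by rw [bToR_eq_bEmb]
  refine ⟨⟨fun n₀ h => bEmb_injective hP hd hm h, fun e₀ h => rEmb_injective hP hd hm h,
      fun n₀ n₁ h₀ h₁ => bEmb_range_le h₀ h₁, fun e₀ h => bEmb_range_le_rEmb_range h,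
      fun e₀ e₁ h₀ h₁ => rEmb_range_le h₀ h₁, bToR_bijective⟩,
    fun D hD hD0 => ⟨fun e₀ h _ => RRing.rEmb_restrictsToNonzeroLND hP hd hm hn hne h hD hD0,
      fun n₀ h => RRing.bEmb_restrictsToNonzeroLND hP hd hm hn hne h hD hD0⟩,
    fun α => ⟨fun e₀ h _ => (RRing.isInvariantSubalgebra_rEmb hP hd hm hn hne h).restrictsToAut
        (rEmb_injective hP hd hm h) α,
      fun n₀ h _ => (RRing.isInvariantSubalgebra_bEmb hP hd hm hn hne h).restrictsToAut
        (bEmb_injective hP hd hm h) α⟩,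
    fun n₁ e₁ n₂ e₂ hn₁ hn₂ => RRing.nonempty_algEquiv_iff hP hd hm hn₁ hn₂,
    ⟨hML.trans (RRing.degAdjoin_zero hP hd hm), hAL.trans h1, RRing.algebraicIndependent_x_s,
      hML ▸ RRing.isInvariantSubalgebra_degAdjoin hP hd hm hn hne 0,
      hAL ▸ RRing.isInvariantSubalgebra_degAdjoin hP hd hm hn hne 1,
      fun n₀ h _ => RRing.isInvariantSubalgebra_bEmb hP hd hm hn hne h,
      fun e₀ h _ => RRing.isInvariantSubalgebra_rEmb hP hd hm hn hne h⟩,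
    rfl, (RRing.Derksen_eq hP hd hm hn hne).trans hML.symm, ?_, fun i hi hi' => ?_, ?_,
    fun i hi hi' => ?_, fun he => ?_, ?_⟩
  · rw [hAL]
    refine SetLike.lt_iff_le_and_exists.2 ⟨?_, RRing.s n e m P, ?_, ?_⟩
    · rw [hML]
      exact Algebra.adjoin_mono (RRing.degFil_mono (by lia))
    · exact Algebra.subset_adjoin RRing.s_mem_degFil
    · rw [RRing.mem_ML_iff hP hd hm hn hne]
      exact RRing.s_notMem_degFil
  · rw [hALi, hAL, h1, RRing.degAdjoin_of_lt hP hd hm hi (by lia)]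
  · rw [hAL, h1, bToR_range]
    refine SetLike.lt_iff_le_and_exists.2 ⟨Algebra.adjoin_mono ?_, RRing.y n e m P,
      Algebra.subset_adjoin (by simp), RRing.y_notMem_adjoin hP hd hm hn⟩
    rintro a (rfl | rfl) <;> simp
  · rw [hALi, RRing.degAdjoin_of_lt_mul hP hd hm hi (by lia)]
  · rw [hALi, RRing.degAdjoin_mul hP hd hm]
    refine SetLike.lt_iff_le_and_exists.2 ⟨le_top, RRing.z n e m P, Algebra.mem_top,
      RRing.z_notMem_range hP hd hm he⟩
  · rw [hALi, RRing.degAdjoin_mul hP hd hm]
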